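/- **Setting.** Let $\mathcal H$ be a reproducing kernel Hilbert space of square integrable functions on $[0,1]$ that integrate to zero. Its kernel is $K(x,y)=\sum_{k\ge1}\mu_k\psi_k(x)\psi_k(y)$, where $1=\mu_1\ge\mu_2\ge\dots\ge0$ and the $\psi_k$ are orthonormal in $L^2([0,1])$ and orthogonal to constants. For integers $p,s,n\ge1$ let $\mathcal F_s$ be the set of $f\in L^2([0,1]^p)$ of the form $f(x)=\sum_{j\in S}f_j(x_j)$ with $S\subset\{1,\dots,p\}$, $|S|\le s$, $f_j\in\mathcal H$ and $\|f_j\|_{\mathcal H}\le1$. One observes $dY_x=f(x)\,dx+n^{-1/2}dB_x$ on $[0,1]^p$ (Gaussian white noise); $P_f$ is the law under the signal $f$. Put $X_{k,j}=\int\psi_k(x_j)\,dY_x$ and $E_j(d)=n\sum_{k\le d}X_{k,j}^2$. For $g\sim N(0,I_d)$ put $$\alpha_r(d)=\frac{E\left(\|g\|^2\mathbf 1_{\{\|g\|^2\ge d+r^2\}}\right)}{P\{\|g\|^2\ge d+r^2\}},\qquad T_r(d)=\sum_{j=1}^p\left(E_j(d)-\alpha_r(d)\right)\mathbf 1_{\{E_j(d)\ge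 d+r^2\}}.$$ Let $\nu_{\mathcal H}$ be the smallest positive integer $\nu$ with $\mu_\nu\le\sqrt{\nu\log(1+p/s^2)}/n$. **Proposition (Bulk).** There is a universal constant $D_0>0$ such that for every $D\ge D_0$ there are positive constants $K_1,K_2,K_3$, depending only on $D$, with the following property. Set $d=\nu_{\mathcal H}\vee\lceil D\rceil$. For every $\eta\in(0,1)$ there is $C_\eta>0$ depending only on $\eta$ (and $D$) such that, whenever $1\le s<\sqrt p$ and $\log(1+p/s^2)\le K_3^2d$, with $$\tau^2=\frac{s\sqrt{\nu_{\mathcal H}\log(1+p/s^2)}}{n},\qquad r=K_2\left(d\log(1+p/s^2)\right)^{1/4},$$ one has for all $C>C_\eta$ $$P_0\left\{T_r(d)>CK_1n\tau^2\right\}+\sup_{f\in\mathcal F_s,\ \|f\|_2\ge C\tau}P_f\left\{T_r(d)\le CK_1n\tau^2\right\}\le\eta .$$ In particular, this holds with universal constants $D,K_1,K_2,K_3$ (take $D=D_0$) and $C_\eta$ depending only on $\eta$. -/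

import Mathlib

open MeasureTheory ProbabilityTheory Finset
open scoped unitInterval RealInnerProductSpace ENNReal

universe u v

namespace SparseAdditive

noncomputable section

/-- A centered reproducing kernel Hilbert space on `[0,1]`: every element is a square integrable
function which integrates to zero. (Completeness is a separate instance argument.) -/
def IsCentered (H : Type*) [NormedAddCommGroup H] [InnerProductSpace ℝ H] [RKHS ℝ H I ℝ] : Prop :=
  ∀ f : H, MemLp (fun x : I => f x) 2 volume ∧ ∫ x : I, f x = 0

/-- `μ` and `ψ` are the eigenvalues (in nonincreasing order, with top eigenvalue `1`) and the
eigenfunctions of the centered space `H`: the `ψ k` are orthonormal in `L²([0,1])`, orthogonal to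
the constants, and the reproducing kernel is `K(x,y) = ∑ₖ μₖ ψₖ(x) ψₖ(y)`.
The index is shifted by one: `μ k` is the `(k+1)`-st eigenvalue. -/
structure IsEigensystem (H : Type*) [NormedAddCommGroup H] [InnerProductSpace ℝ H]
    [CompleteSpace H] [RKHS ℝ H I ℝ] (μ : ℕ → ℝ) (ψ : ℕ → I → ℝ) : Prop where
  memLp : ∀ k, MemLp (ψ k) 2 (volume : Measure I)
  orthonormal : ∀ k l, ∫ x : I, ψ k x * ψ l x = if k = l then 1 else 0
  integral_eq_zero : ∀ k, ∫ x : I, ψ k x = 0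
  antitone : Antitone μ
  nonneg : ∀ k, 0 ≤ μ k
  top_eq_one : μ 0 = 1
  kernel_expansion : ∀ x y : I, HasSum (fun k => μ k * ψ k x * ψ k y) (RKHS.kernel H x y 1)

/-- The space `L²([0,1]^p)`. -/
abbrev L2Cube (p : ℕ) : Type := Lp ℝ 2 (volume : Measure (Fin p → I))

/-- The class `𝓕ₛ` of sparse additive signals `f(x) = ∑_{j ∈ S} f_j(x_j)`, `|S| ≤ s`, with `f_j`
in the unit ball of `H`, as a subset of `L²([0,1]^p)`. -/
def signalClass (H : Type*) [NormedAddCommGroup H] [InnerProductSpace ℝ H] [RKHS ℝ H I ℝ]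
    (p s : ℕ) : Set (L2Cube p) :=
  {f | ∃ S : Finset (Fin p), S.card ≤ s ∧ ∃ g : Fin p → H, (∀ j ∈ S, ‖g j‖ ≤ 1) ∧
    f =ᵐ[volume] fun x => ∑ j ∈ S, g j (x j)}

/-- Gaussian white noise on a real inner product space `E` (an isonormal Gaussian process):
a centered Gaussian family `(W h)_{h ∈ E}` with `Cov (W g, W h) = ⟪g, h⟫`. For `E = L²([0,1]^p)`,
`W h` is the Wiener integral `∫ h dB`. -/
structure IsWhiteNoise {E Ω : Type*} [NormedAddCommGroup E] [InnerProductSpace ℝ E]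
    [MeasurableSpace Ω] (W : E → Ω → ℝ) (P : Measure Ω) : Prop where
  isGaussianProcess : IsGaussianProcess W P
  mean_zero : ∀ h, ∫ ω, W h ω ∂P = 0
  covariance : ∀ g h, cov[W g, W h; P] = ⟪g, h⟫

/-- `∫ h dY` for the observation `dY_x = f(x) dx + n^{-1/2} dB_x`, `W h` being `∫ h dB`. -/
def whiteNoiseModel {E Ω : Type*} [NormedAddCommGroup E] [InnerProductSpace ℝ E]
    (n : ℕ) (W : E → Ω → ℝ) (f h : E) (ω : Ω) : ℝ :=
  ⟪f, h⟫ + (1 / √(n : ℝ)) * W h ω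

/-- A function `u ∈ L²([0,1])` of the `j`-th coordinate, as an element of `L²([0,1]^p)`. -/
def coordFun {p : ℕ} (u : I → ℝ) (hu : MemLp u 2 (volume : Measure I)) (j : Fin p) : L2Cube p :=
  (hu.comp_measurePreserving
    (measurePreserving_eval (fun _ : Fin p => (volume : Measure I)) j)).toLp (u ∘ fun x : Fin p → I => x j)

/-- The data `X_{k,j} = ∫ φ_{j,k} dY`, `φ_{j,k}(x) = ψ_k(x_j)`, observed under the signal `f`. -/
def sequenceData {p : ℕ} {Ω : Type*} (n : ℕ) (ψ : ℕ → I → ℝ)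
    (hψ : ∀ k, MemLp (ψ k) 2 (volume : Measure I)) (W : L2Cube p → Ω → ℝ) (f : L2Cube p)
    (ω : Ω) (k : ℕ) (j : Fin p) : ℝ :=
  whiteNoiseModel n W f (coordFun (ψ k) (hψ k) j) ω

/-- `α_r(d) = E(‖g‖² 1{‖g‖² ≥ d + r²}) / P(‖g‖² ≥ d + r²)` for `g ∼ N(0, I_d)`. -/
def alpha (d : ℕ) (r : ℝ) : ℝ :=
  (∫ g in {g : EuclideanSpace ℝ (Fin d) | (d : ℝ) + r ^ 2 ≤ ‖g‖ ^ 2},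
      ‖g‖ ^ 2 ∂(stdGaussian (EuclideanSpace ℝ (Fin d)))) /
    (stdGaussian (EuclideanSpace ℝ (Fin d))).real
      {g : EuclideanSpace ℝ (Fin d) | (d : ℝ) + r ^ 2 ≤ ‖g‖ ^ 2}

/-- `E_j(d) = n ∑_{k ≤ d} X_{k,j}²` (the first `d` coefficients). -/
def energy {p : ℕ} (n d : ℕ) (X : ℕ → Fin p → ℝ) (j : Fin p) : ℝ :=
  n * ∑ k ∈ range d, X k j ^ 2

open Classical in
/-- `T_r(d) = ∑_j (E_j(d) - α_r(d)) 1{E_j(d) ≥ d + r²}`. -/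
def testStatistic {p : ℕ} (n d : ℕ) (r : ℝ) (X : ℕ → Fin p → ℝ) : ℝ :=
  ∑ j, if (d : ℝ) + r ^ 2 ≤ energy n d X j then energy n d X j - alpha d r else 0

/-- The sparsity factor `log (1 + p / s²)`. -/
def logFactor (p s : ℕ) : ℝ := Real.log (1 + (p : ℝ) / (s : ℝ) ^ 2)

/-- `ν_H`: the smallest positive integer `ν` such that the `ν`-th eigenvalue (which is `μ (ν - 1)`
with the shifted index) is at most `√(ν log (1 + p / s²)) / n`. -/
def truncationOrder (μ : ℕ → ℝ) (p s n : ℕ) : ℕ :=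
  sInf {ν : ℕ | 1 ≤ ν ∧ μ (ν - 1) ≤ √((ν : ℝ) * logFactor p s) / n}

/-- The order `d = ν_H ∨ ⌈D⌉` of the test statistic. -/
def testOrder (D : ℝ) (μ : ℕ → ℝ) (p s n : ℕ) : ℕ :=
  max (truncationOrder μ p s n) ⌈D⌉₊

/-- The bulk rate `τ(p, s, n)`, with `τ² = s √(ν_H log (1 + p / s²)) / n`. -/
def bulkRate (μ : ℕ → ℝ) (p s n : ℕ) : ℝ :=
  √((s : ℝ) * √((truncationOrder μ p s n : ℝ) * logFactor p s) / n)

/-- The total testing risk, type I error plus worst type II error over `{f ∈ 𝓕ₛ : ‖f‖₂ ≥ ε}`, of the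
test which rejects when `T_r(d) > t`. -/
def totalRisk (H : Type*) [NormedAddCommGroup H] [InnerProductSpace ℝ H] [RKHS ℝ H I ℝ]
    {Ω : Type*} [MeasurableSpace Ω] (P : Measure Ω) {p : ℕ} (W : L2Cube p → Ω → ℝ) (s n d : ℕ)
    (ψ : ℕ → I → ℝ) (hψ : ∀ k, MemLp (ψ k) 2 (volume : Measure I)) (r t ε : ℝ) : ℝ≥0∞ :=
  P {ω | t < testStatistic n d r (sequenceData n ψ hψ W 0 ω)} +
    ⨆ f ∈ {f : L2Cube p | f ∈ signalClass H p s ∧ ε ≤ ‖f‖},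
      P {ω | testStatistic n d r (sequenceData n ψ hψ W f ω) ≤ t}

end

end SparseAdditive

/-!
The proof is a first and second moment argument for the test statistic `T_r(d)`.

*Probability.* Since the functions `φ_{j,k}(x) = ψ_k(x_j)` are orthonormal, the noise vectors
`G_j = (W φ_{j,k})_{k < d}` are independent standard Gaussian vectors (`iIndepFun_noiseVec`,
`map_noiseVec`), and `E_j(d) = ‖a_j + G_j‖²`, where `a_j` is `√n` times the vector of the first `d`
coefficients of the signal on the `j`-th coordinate (`energy_eq_norm_sq`).

*Type I error.* Under the null every summand is centered, by the definition of `α_r(d)`. Its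
variance is at most `E (‖g‖² - d)² 1{‖g‖² ≥ d + r²}`, which the moment generating function of
`‖g‖² - d` bounds by a multiple of `d L e^{-L}`, with `L = log (1 + p / s²)`; hence the variance of `T_r(d)` is of
order `s² d L` (`mul_integral_thresholded_sq_le`), and Chebyshev's inequality applies.

*Type II error.* As `α_r(d)` is at least the threshold `d + r²`, each summand is at least
`E_j(d) - α_r(d)`. On the at most `s` active coordinates this bound has mean `‖a_j‖² - (α_r(d) - d)`
and variance of order `d + ‖a_j‖²`, and the other coordinates behave as under the null
(`measure_testStatistic_le_le`). It remains to know that `α_r(d) - d` is of order `r²`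
(`alpha_sub_le`), which follows from Jensen's inequality and a Paley–Zygmund lower bound on the
probability of the tail event (`le_measureReal_tailSet`), and that `∑_j ‖a_j‖² ≥ n (‖f‖² - s μ_d)`.

*Approximation.* The last bound rests on the expansion of the elements of the reproducing kernel
Hilbert space as `f = ∑ₖ aₖ √μₖ ψₖ` with `∑ₖ aₖ² = ‖f‖²`, which is read off from the pointwise
expansion of the kernel (`IsEigensystem.exists_hasSum`, `IsEigensystem.exists_support`).

Since `L ≥ 1/2` and `d ≤ ⌈D⌉ ν_H`, all these quantities are comparable to powers of
`n τ² = s √(ν_H L)`. The constants are `D₀ = 1`, `K₁ = 1`, `K₂ = 3` and `K₃ = 1/144`; the latter two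
make `r²` at most `d / 16`, which keeps the exponential moments finite.
-/

namespace SparseAdditive

/-! ### Eigenfunction expansions in the reproducing kernel Hilbert space -/

open Filter Topology in
/-- If two families `k` and `Φ` of vectors have the same Gram matrix, then every vector in the
closed span of `k` is represented, with the same norm, through the family `Φ`. -/
lemma exists_eq_inner_of_inner_eq {X E G : Type*} [NormedAddCommGroup E] [InnerProductSpace ℝ E]
    [NormedAddCommGroup G] [InnerProductSpace ℝ G] [CompleteSpace G] {k : X → E} {Φ : X → G}
    (h : ∀ x y, ⟪k x, k y⟫ = ⟪Φ x, Φ y⟫) {f : E}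
    (hf : f ∈ closure (Submodule.span ℝ (Set.range k) : Set E)) :
    ∃ a : G, ‖a‖ = ‖f‖ ∧ ∀ x, ⟪a, Φ x⟫ = ⟪f, k x⟫ := by
  set u := Finsupp.linearCombination ℝ k
  set v := Finsupp.linearCombination ℝ Φ
  have huv (c e : X →₀ ℝ) : ⟪u c, u e⟫ = ⟪v c, v e⟫ := by
    simp only [u, v, Finsupp.linearCombination_apply, Finsupp.sum_inner, Finsupp.inner_sum, h,
      real_inner_smul_left, real_inner_smul_right]
  have hnorm (c : X →₀ ℝ) : ‖u c‖ = ‖v c‖ := by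
    rw [← sq_eq_sq₀ (norm_nonneg _) (norm_nonneg _), ← real_inner_self_eq_norm_sq,
      ← real_inner_self_eq_norm_sq, huv]
  obtain ⟨w, hw, hwf⟩ := mem_closure_iff_seq_limit.1 hf
  have hex (m : ℕ) : ∃ c, u c = w m := by
    have := hw m
    rw [SetLike.mem_coe, Finsupp.mem_span_range_iff_exists_finsupp] at this
    obtain ⟨c, hc⟩ := this
    exact ⟨c, by rw [← hc, Finsupp.linearCombination_apply]⟩
  choose c hc using hex
  have hcauchy : CauchySeq (fun m => v (c m)) := by
    have h1 := hwf.cauchySeq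
    rw [Metric.cauchySeq_iff] at h1 ⊢
    intro ε hε
    obtain ⟨N, hN⟩ := h1 ε hε
    refine ⟨N, fun m hm l hl => ?_⟩
    have := hN m hm l hl
    rwa [← hc, ← hc, dist_eq_norm, ← map_sub, hnorm, map_sub, ← dist_eq_norm] at this
  obtain ⟨a, ha⟩ := cauchySeq_tendsto_of_complete hcauchy
  refine ⟨a, ?_, fun x => ?_⟩
  · refine tendsto_nhds_unique ha.norm ?_
    simp_rw [← hnorm, hc]
    exact hwf.norm
  · refine tendsto_nhds_unique (ha.inner tendsto_const_nhds) ?_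
    have h2 (m : ℕ) : ⟪v (c m), Φ x⟫ = ⟪w m, k x⟫ := by
      have := huv (c m) (Finsupp.single x 1)
      simp only [u, v, Finsupp.linearCombination_single, one_smul] at this
      rw [← this, ← hc]
    simp_rw [h2]
    exact hwf.inner tendsto_const_nhds

section Eigen

variable {H : Type*} [NormedAddCommGroup H] [InnerProductSpace ℝ H] [CompleteSpace H]
  [RKHS ℝ H I ℝ] {μ : ℕ → ℝ} {ψ : ℕ → I → ℝ}

/-- Every `f ∈ H` has an expansion `f = ∑ₖ aₖ √μₖ ψₖ`, converging pointwise, with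
`∑ₖ aₖ² = ‖f‖²`. -/
lemma IsEigensystem.exists_hasSum (hψ : IsEigensystem H μ ψ) (f : H) :
    ∃ a : ℕ → ℝ, HasSum (fun k => a k ^ 2) (‖f‖ ^ 2) ∧
      ∀ x, HasSum (fun k => a k * √(μ k) * ψ k x) (f x) := by
  have hmem (x : I) : Memℓp (fun k => √(μ k) * ψ k x) 2 := by
    rw [memℓp_gen_iff (by norm_num)]
    convert! (hψ.kernel_expansion x x).summable using 2 with k
    simp only [ENNReal.toReal_ofNat, Real.rpow_ofNat, Real.norm_eq_abs, sq_abs, mul_pow,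
      Real.sq_sqrt (hψ.nonneg k)]
    ring
  let Φ (x : I) : lp (fun _ : ℕ => ℝ) 2 := ⟨_, hmem x⟩
  have hgram (x y : I) : ⟪RKHS.kerFun H x (1 : ℝ), RKHS.kerFun H y (1 : ℝ)⟫ = ⟪Φ x, Φ y⟫ := by
    have h1 : ⟪RKHS.kerFun H x (1 : ℝ), RKHS.kerFun H y (1 : ℝ)⟫ = RKHS.kernel H x y 1 := by
      rw [RKHS.kerFun_inner, RKHS.kerFun_apply]
      simp
    rw [h1]
    refine (hψ.kernel_expansion x y).unique ?_
    convert! lp.hasSum_inner (𝕜 := ℝ) (Φ x) (Φ y) using 2 with k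
    simp only [Φ, RCLike.inner_apply, conj_trivial]
    linear_combination (-ψ k x * ψ k y) * Real.mul_self_sqrt (hψ.nonneg k)
  have hf : f ∈ closure
      (Submodule.span ℝ (Set.range fun x => RKHS.kerFun H x (1 : ℝ)) : Set H) := by
    have h1 := RKHS.kerFun_dense (𝕜 := ℝ) (X := I) (V := ℝ) H
    have h2 : Submodule.span ℝ {RKHS.kerFun H x v | (x : I) (v : ℝ)} ≤
        Submodule.span ℝ (Set.range fun x => RKHS.kerFun H x (1 : ℝ)) := by
      rw [Submodule.span_le]
      rintro _ ⟨x, v, rfl⟩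
      have : RKHS.kerFun H x v = v • RKHS.kerFun H x (1 : ℝ) := by
        rw [← map_smul]; simp
      rw [this]
      exact Submodule.smul_mem _ _ (Submodule.subset_span ⟨x, rfl⟩)
    have h3 : f ∈ (⊤ : Submodule ℝ H) := trivial
    rw [← h1] at h3
    exact closure_mono h2 h3
  obtain ⟨a, ha, hax⟩ := exists_eq_inner_of_inner_eq hgram hf
  refine ⟨a, ?_, fun x => ?_⟩
  · rw [← ha, ← real_inner_self_eq_norm_sq]
    convert! lp.hasSum_inner (𝕜 := ℝ) a a using 2 with k
    simp [sq]
  · have h1 := lp.hasSum_inner (𝕜 := ℝ) a (Φ x)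
    rw [hax, RKHS.inner_kerFun] at h1
    convert! h1 using 2 with k
    · simp only [Φ, RCLike.inner_apply, conj_trivial]; ring
    · simp

open Filter in
/-- The eigenfunctions with index at least `d` carry at most `μ_d ‖f‖²_H` of the squared `L²` norm
of `f ∈ H`. -/
lemma IsEigensystem.integral_sq_sub_le (hψ : IsEigensystem H μ ψ) (f : H)
    (hf : MemLp (fun x : I => f x) 2 volume) (d : ℕ) :
    (∫ x : I, f x ^ 2) - μ d * ‖f‖ ^ 2 ≤ ∑ k ∈ range d, (∫ x : I, f x * ψ k x) ^ 2 := by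
  obtain ⟨a, ha, hax⟩ := hψ.exists_hasSum f
  set F : Lp ℝ 2 (volume : Measure I) := hf.toLp with hF
  set e : ℕ → Lp ℝ 2 (volume : Measure I) := fun k => (hψ.memLp k).toLp with he
  have hee (k l : ℕ) : ⟪e k, e l⟫ = if k = l then 1 else 0 := by
    rw [L2.inner_def, ← hψ.orthonormal k l]
    refine integral_congr_ae ?_
    filter_upwards [(hψ.memLp k).coeFn_toLp, (hψ.memLp l).coeFn_toLp] with x hx hy
    simp only [he, hx, hy, RCLike.inner_apply, conj_trivial]
    ring
  have hon : Orthonormal ℝ e := orthonormal_iff_ite.2 hee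
  have hFe (k : ℕ) : ⟪F, e k⟫ = ∫ x : I, f x * ψ k x := by
    rw [L2.inner_def]
    refine integral_congr_ae ?_
    filter_upwards [(hψ.memLp k).coeFn_toLp, hf.coeFn_toLp] with x hx hy
    simp only [he, hF, hx, hy, RCLike.inner_apply, conj_trivial]
    ring
  have hFF : ⟪F, F⟫ = ∫ x : I, f x ^ 2 := by
    rw [L2.inner_def]
    refine integral_congr_ae ?_
    filter_upwards [hf.coeFn_toLp] with x hy
    simp only [hF, hy, RCLike.inner_apply, conj_trivial]
    ring
  set b : ℕ → ℝ := fun k => a k * √(μ k) with hb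
  have hb2 (k : ℕ) : b k ^ 2 = a k ^ 2 * μ k := by
    rw [hb, mul_pow, Real.sq_sqrt (hψ.nonneg k)]
  have hbsum : Summable fun k => b k ^ 2 := by
    refine Summable.of_nonneg_of_le (fun k => sq_nonneg _) (fun k => ?_) ha.summable
    rw [hb2]
    have : μ k ≤ 1 := hψ.top_eq_one ▸ hψ.antitone (Nat.zero_le k)
    nlinarith [sq_nonneg (a k)]
  have hsum : Summable fun k => b k • e k := by
    have := (hon.orthogonalFamily.summable_iff_norm_sq_summable b).2 (by simpa using hbsum)
    simpa using this
  obtain ⟨G, hG⟩ := hsum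
  -- The `L²` limit `G` of the expansion agrees with its pointwise limit `f`, as a subsequence of the
  -- partial sums converges to `G` almost everywhere.
  have hGF : G = F := by
    obtain ⟨ns, hns, hlim⟩ :=
      (tendstoInMeasure_of_tendsto_Lp hG.tendsto_sum_nat).exists_seq_tendsto_ae
    refine Lp.ext ?_
    have hcoe : ∀ᵐ x : I, ∀ m, (∑ k ∈ range m, b k • e k : Lp ℝ 2 (volume : Measure I)) x =
        ∑ k ∈ range m, b k * ψ k x := by
      rw [ae_all_iff]
      intro m
      filter_upwards [Lp.coeFn_finsetSum (range m) fun k => b k • e k,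
        ae_all_iff.2 fun k => Lp.coeFn_smul (b k) (e k),
        ae_all_iff.2 fun k => (hψ.memLp k).coeFn_toLp] with x h1 h2 h3
      rw [h1, Finset.sum_apply]
      refine Finset.sum_congr rfl fun k _ => ?_
      rw [h2 k, Pi.smul_apply, smul_eq_mul, he, h3 k]
    filter_upwards [hcoe, hlim, hf.coeFn_toLp] with x h1 h2 h3
    rw [hF, h3]
    refine tendsto_nhds_unique h2 ?_
    simp_rw [h1]
    exact (hax x).tendsto_sum_nat.comp hns.tendsto_atTop
  subst hGF
  have hbk (k : ℕ) : ⟪F, e k⟫ = b k := by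
    refine (hG.mapL ((innerSL ℝ).flip (e k))).unique ?_
    convert! hasSum_ite_eq k (b k) using 2 with l
    simp only [ContinuousLinearMap.flip_apply, innerSL_apply_apply, real_inner_smul_left, hee]
    split_ifs with h
    · rw [h, mul_one]
    · simp
  have hnorm : HasSum (fun k => b k ^ 2) (∫ x : I, f x ^ 2) := by
    rw [← hFF]
    convert! hG.mapL ((innerSL ℝ) F) using 2 with k
    simp only [innerSL_apply_apply, real_inner_smul_right, hbk, sq]
  simp_rw [← hFe, hbk]
  have h1 := (hasSum_nat_add_iff' d).2 hnorm
  have h2 : HasSum (fun k => μ d * a (k + d) ^ 2) (μ d * (‖f‖ ^ 2 - ∑ k ∈ range d, a k ^ 2)) :=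
    ((hasSum_nat_add_iff' d).2 ha).mul_left _
  have h3 := hasSum_le (fun k => ?_) h1 h2
  · have : 0 ≤ ∑ k ∈ range d, a k ^ 2 := Finset.sum_nonneg fun k _ => sq_nonneg _
    nlinarith [hψ.nonneg d]
  · rw [hb2, mul_comm]
    exact mul_le_mul_of_nonneg_right (hψ.antitone (Nat.le_add_left d k)) (sq_nonneg _)

end Eigen

/-! ### Sparse additive signals on the cube -/

section Cube

variable {p : ℕ}

lemma coordFun_coeFn {u : I → ℝ} (hu : MemLp u 2 (volume : Measure I)) (j : Fin p) :
    coordFun u hu j =ᵐ[volume] fun x : Fin p → I => u (x j) :=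
  MemLp.coeFn_toLp _

lemma integral_comp_eval {u : I → ℝ} (hu : AEStronglyMeasurable u volume) (j : Fin p) :
    ∫ x : Fin p → I, u (x j) = ∫ t : I, u t := by
  have h := measurePreserving_eval (fun _ : Fin p => (volume : Measure I)) j
  rw [← h.map_eq, integral_map h.measurable.aemeasurable (by rwa [h.map_eq])]
  rfl

lemma inner_coordFun {u v : I → ℝ} (hu : MemLp u 2 (volume : Measure I))
    (hv : MemLp v 2 (volume : Measure I)) (i j : Fin p) :
    ⟪coordFun u hu i, coordFun v hv j⟫ =
      if i = j then ∫ t : I, u t * v t else (∫ t : I, u t) * ∫ t : I, v t := by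
  have h : ⟪coordFun u hu i, coordFun v hv j⟫ = ∫ x : Fin p → I, u (x i) * v (x j) := by
    rw [L2.inner_def]
    refine integral_congr_ae ?_
    filter_upwards [coordFun_coeFn hu i, coordFun_coeFn hv j] with x hx hy
    simp only [hx, hy, RCLike.inner_apply, conj_trivial]
    ring
  rw [h]
  have hm {w : I → ℝ} (hw : MemLp w 2 (volume : Measure I)) (l : Fin p) :
      AEMeasurable (fun x : Fin p → I => w (x l)) volume :=
    hw.1.aemeasurable.comp_quasiMeasurePreserving (Measure.quasiMeasurePreserving_eval _ l)
  split_ifs with hij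
  · subst hij
    exact integral_comp_eval (u := fun t => u t * v t) (hu.1.mul hv.1) i
  · have hind := iIndepFun_pi (μ := fun _ : Fin p => (volume : Measure I))
      (X := fun l : Fin p => if l = i then u else v) (fun l => by
        split_ifs; exacts [hu.1.aemeasurable, hv.1.aemeasurable])
    have h2 := hind.indepFun hij
    simp only [if_true, if_neg (Ne.symm hij)] at h2
    rw [← integral_comp_eval hu.1 i, ← integral_comp_eval hv.1 j]
    exact h2.integral_fun_mul_eq_mul_integral (hm hu i).aestronglyMeasurable
      (hm hv j).aestronglyMeasurable

variable {H : Type*} [NormedAddCommGroup H] [InnerProductSpace ℝ H] [CompleteSpace H]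
  [RKHS ℝ H I ℝ] {μ : ℕ → ℝ} {ψ : ℕ → I → ℝ}

lemma IsEigensystem.inner_coordFun_eq_ite (hψ : IsEigensystem H μ ψ) (i j : Fin p) (k l : ℕ) :
    ⟪coordFun (ψ k) (hψ.memLp k) i, coordFun (ψ l) (hψ.memLp l) j⟫ =
      if i = j ∧ k = l then 1 else 0 := by
  rw [inner_coordFun, hψ.orthonormal, hψ.integral_eq_zero]
  split_ifs <;> simp_all

/-- The first `d` coefficients on each active coordinate of a sparse additive signal capture its
squared norm up to the truncation bias `s μ_d`; the inactive coordinates carry no signal. -/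
lemma IsEigensystem.exists_support (hc : IsCentered H) (hψ : IsEigensystem H μ ψ) {s : ℕ}
    {f : L2Cube p} (hf : f ∈ signalClass H p s) (d : ℕ) :
    ∃ S : Finset (Fin p), S.card ≤ s ∧
      (∀ j ∉ S, ∀ k, ⟪f, coordFun (ψ k) (hψ.memLp k) j⟫ = 0) ∧
      ‖f‖ ^ 2 - s * μ d ≤
        ∑ j ∈ S, ∑ k ∈ range d, ⟪f, coordFun (ψ k) (hψ.memLp k) j⟫ ^ 2 := by
  obtain ⟨S, hS, g, hg, hfg⟩ := hf
  have hfsum : f = ∑ j ∈ S, coordFun (g j) (hc (g j)).1 j := by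
    refine Lp.ext ?_
    filter_upwards [hfg, Lp.coeFn_finsetSum S fun j => coordFun (g j) (hc (g j)).1 j,
      ae_all_iff.2 fun j => coordFun_coeFn (hc (g j)).1 j] with x h1 h2 h3
    rw [h1, h2, Finset.sum_apply]
    exact Finset.sum_congr rfl fun j _ => (h3 j).symm
  have hcoef (j : Fin p) (k : ℕ) : ⟪f, coordFun (ψ k) (hψ.memLp k) j⟫ =
      if j ∈ S then ∫ t : I, g j t * ψ k t else 0 := by
    rw [hfsum, sum_inner]
    simp_rw [inner_coordFun, hψ.integral_eq_zero, mul_zero]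
    rw [Finset.sum_ite_eq' S j]
  refine ⟨S, hS, fun j hj k => by rw [hcoef, if_neg hj], ?_⟩
  have hnorm : ‖f‖ ^ 2 = ∑ j ∈ S, ∫ t : I, g j t ^ 2 := by
    rw [← real_inner_self_eq_norm_sq]
    conv_lhs => rw [hfsum]
    rw [sum_inner]
    refine Finset.sum_congr rfl fun i hi => ?_
    rw [inner_sum]
    simp_rw [inner_coordFun, (hc (g i)).2, zero_mul]
    rw [Finset.sum_ite_eq S i, if_pos hi]
    simp_rw [sq]
  have h1 (j) (hj : j ∈ S) : (∫ t : I, g j t ^ 2) - μ d ≤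
      ∑ k ∈ range d, ⟪f, coordFun (ψ k) (hψ.memLp k) j⟫ ^ 2 := by
    have h2 := hψ.integral_sq_sub_le (g j) (hc (g j)).1 d
    have h3 : ‖g j‖ ^ 2 ≤ 1 := pow_le_one₀ (norm_nonneg _) (hg j hj)
    simp_rw [hcoef, if_pos hj]
    nlinarith [hψ.nonneg d]
  have h4 := Finset.sum_le_sum h1
  rw [Finset.sum_sub_distrib, ← hnorm, Finset.sum_const, nsmul_eq_mul] at h4
  have h5 : (S.card : ℝ) ≤ s := by exact_mod_cast hS
  nlinarith [hψ.nonneg d]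

end Cube

/-! ### Exponential moments of the chi-squared law -/

/-- The standard Gaussian measure `N(0, I_d)`. -/
noncomputable abbrev gauss (d : ℕ) : Measure (EuclideanSpace ℝ (Fin d)) := stdGaussian _

/-- The rejection region `{‖g‖² ≥ d + r²}` of a single coordinate. -/
def tailSet (d : ℕ) (r : ℝ) : Set (EuclideanSpace ℝ (Fin d)) := {g | (d : ℝ) + r ^ 2 ≤ ‖g‖ ^ 2}

lemma measurableSet_tailSet (d : ℕ) (r : ℝ) : MeasurableSet (tailSet d r) :=
  measurableSet_le measurable_const (by fun_prop)

lemma gaussianPDFReal_mul_exp_sq (θ x : ℝ) :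
    gaussianPDFReal 0 1 x • Real.exp (θ * x ^ 2) =
      (√(2 * Real.pi))⁻¹ * Real.exp (-(1 / 2 - θ) * x ^ 2) := by
  rw [gaussianPDFReal_def]
  simp only [NNReal.coe_one, mul_one, sub_zero, smul_eq_mul]
  rw [mul_assoc, ← Real.exp_add]
  congr 2
  ring

lemma integrable_exp_sq_gaussianReal {θ : ℝ} (hθ : θ < 1 / 2) :
    Integrable (fun x => Real.exp (θ * x ^ 2)) (gaussianReal 0 1) := by
  rw [gaussianReal_of_var_ne_zero 0 one_ne_zero,
    integrable_withDensity_iff_integrable_smul' (measurable_gaussianPDF 0 1)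
      (by filter_upwards with x; exact gaussianPDF_lt_top)]
  simp_rw [toReal_gaussianPDF, gaussianPDFReal_mul_exp_sq]
  exact (integrable_exp_neg_mul_sq (by linarith)).const_mul _

lemma integral_exp_sq_gaussianReal {θ : ℝ} (hθ : θ < 1 / 2) :
    ∫ x, Real.exp (θ * x ^ 2) ∂(gaussianReal 0 1) = (√(1 - 2 * θ))⁻¹ := by
  rw [integral_gaussianReal_eq_integral_smul one_ne_zero]
  simp_rw [gaussianPDFReal_mul_exp_sq]
  rw [integral_const_mul, integral_gaussian, ← Real.sqrt_inv, ← Real.sqrt_inv,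
    ← Real.sqrt_mul (by positivity)]
  congr 1
  have : 1 - 2 * θ ≠ 0 := by linarith
  have h2 : (1 / 2 - θ) ≠ 0 := by linarith
  have := Real.pi_ne_zero
  field_simp

section Chi

variable {d : ℕ}

lemma exp_norm_sq_sub_eq_prod (θ : ℝ) (x : Fin d → ℝ) :
    Real.exp (θ * (‖(WithLp.toLp 2 x : EuclideanSpace ℝ (Fin d))‖ ^ 2 - d)) =
      ∏ i, (Real.exp (-θ) * Real.exp (θ * x i ^ 2)) := by
  rw [EuclideanSpace.real_norm_sq_eq, Finset.prod_mul_distrib, Finset.prod_const, ← Real.exp_sum,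
    ← Real.exp_nat_mul, ← Real.exp_add, Finset.card_univ, Fintype.card_fin, mul_sub,
    Finset.mul_sum]
  congr 1
  ring

lemma integrable_exp_chi {θ : ℝ} (hθ : θ < 1 / 2) :
    Integrable (fun g => Real.exp (θ * (‖g‖ ^ 2 - d))) (gauss d) := by
  rw [gauss, ← map_pi_eq_stdGaussian, integrable_map_measure (by fun_prop) (by fun_prop)]
  simp_rw [Function.comp_def, exp_norm_sq_sub_eq_prod]
  exact Integrable.fintype_prod fun _ => (integrable_exp_sq_gaussianReal hθ).const_mul _

lemma integral_exp_chi {θ : ℝ} (hθ : θ < 1 / 2) :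
    ∫ g, Real.exp (θ * (‖g‖ ^ 2 - d)) ∂(gauss d) =
      (Real.exp (-θ) * (√(1 - 2 * θ))⁻¹) ^ d := by
  rw [gauss, ← map_pi_eq_stdGaussian, integral_map (by fun_prop) (by fun_prop)]
  simp_rw [exp_norm_sq_sub_eq_prod]
  rw [integral_fintype_prod_eq_pow (fun x => Real.exp (-θ) * Real.exp (θ * x ^ 2)),
    integral_const_mul, integral_exp_sq_gaussianReal hθ, Fintype.card_fin]

lemma exp_neg_mul_inv_sqrt_le {θ : ℝ} (h2 : θ ≤ 1 / 4) :
    Real.exp (-θ) * (√(1 - 2 * θ))⁻¹ ≤ Real.exp (2 * θ ^ 2) := by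
  have hpos : 0 < 1 - 2 * θ := by linarith
  rw [← div_eq_mul_inv, div_le_iff₀ (by positivity)]
  have key : Real.exp (-(2 * θ + 4 * θ ^ 2)) ≤ 1 - 2 * θ := by
    rw [Real.exp_neg]
    refine inv_le_of_inv_le₀ hpos ?_
    rw [inv_le_iff_one_le_mul₀ hpos]
    rcases le_total θ 0 with h | h
    · have := Real.add_one_le_exp (2 * θ + 4 * θ ^ 2)
      nlinarith [mul_nonneg (neg_nonneg.2 h) (sq_nonneg θ)]
    · have := Real.quadratic_le_exp_of_nonneg (x := 2 * θ + 4 * θ ^ 2) (by positivity)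
      nlinarith [mul_nonneg (mul_nonneg h h) (sub_nonneg.2 h2),
        mul_nonneg (mul_nonneg (mul_nonneg h h) h) (sub_nonneg.2 h2),
        mul_nonneg (mul_nonneg (mul_nonneg (mul_nonneg h h) h) h) (sub_nonneg.2 h2)]
  have h3 : Real.exp (-θ - 2 * θ ^ 2) ≤ √(1 - 2 * θ) := by
    apply Real.le_sqrt_of_sq_le
    rw [← Real.exp_nat_mul]
    convert key using 2
    push_cast; ring
  calc Real.exp (-θ) = Real.exp (2 * θ ^ 2) * Real.exp (-θ - 2 * θ ^ 2) := by
        rw [← Real.exp_add]; congr 1; ring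
    _ ≤ _ := by gcongr

lemma le_exp_neg_mul_inv_sqrt {θ : ℝ} (h1 : 0 ≤ θ) (h2 : θ ≤ 1 / 4) :
    Real.exp (θ ^ 2) ≤ Real.exp (-θ) * (√(1 - 2 * θ))⁻¹ := by
  have hpos : 0 < 1 - 2 * θ := by linarith
  have habs : |2 * θ| < 1 := by rw [abs_of_nonneg] <;> linarith
  have hlog := sum_le_hasSum (range 2) (fun i _ => by positivity)
    (Real.hasSum_pow_div_log_of_abs_lt_one habs)
  simp only [Finset.sum_range_succ, Finset.sum_range_zero] at hlog
  norm_num at hlog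
  rw [← div_eq_mul_inv, le_div_iff₀ (by positivity), Real.sqrt_eq_rpow, Real.rpow_def_of_pos hpos,
    ← Real.exp_add]
  apply Real.exp_le_exp.2
  nlinarith

lemma integral_exp_chi_le {θ : ℝ} (h2 : θ ≤ 1 / 4) :
    ∫ g, Real.exp (θ * (‖g‖ ^ 2 - d)) ∂(gauss d) ≤ Real.exp (2 * d * θ ^ 2) := by
  rw [integral_exp_chi (by linarith)]
  calc _ ≤ Real.exp (2 * θ ^ 2) ^ d :=
        pow_le_pow_left₀ (by positivity) (exp_neg_mul_inv_sqrt_le h2) d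
    _ = _ := by rw [← Real.exp_nat_mul]; congr 1; ring

lemma le_integral_exp_chi {θ : ℝ} (h1 : 0 ≤ θ) (h2 : θ ≤ 1 / 4) :
    Real.exp (d * θ ^ 2) ≤ ∫ g, Real.exp (θ * (‖g‖ ^ 2 - d)) ∂(gauss d) := by
  rw [integral_exp_chi (by linarith), Real.exp_nat_mul]
  exact pow_le_pow_left₀ (by positivity) (le_exp_neg_mul_inv_sqrt h1 h2) d

lemma sq_le_exp_add_exp (y : ℝ) : y ^ 2 ≤ 2 * (Real.exp y + Real.exp (-y)) := by
  have h : y ^ 2 ≤ 2 * Real.exp |y| := by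
    have := Real.quadratic_le_exp_of_nonneg (abs_nonneg y)
    rw [sq_abs] at this
    linarith [abs_nonneg y]
  rcases abs_cases y with ⟨h1, _⟩ | ⟨h1, _⟩ <;> rw [h1] at h <;>
    linarith [Real.exp_pos y, Real.exp_pos (-y)]

/-- The scale `1/√d` of the exponent is that of the fluctuations of `‖g‖² - d`, so that both
exponentials have bounded expectation. -/
lemma chi_sq_le (hd : 0 < d) (g : EuclideanSpace ℝ (Fin d)) :
    (‖g‖ ^ 2 - d) ^ 2 ≤ 32 * d * (Real.exp (1 / (4 * √d) * (‖g‖ ^ 2 - d)) +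
      Real.exp (-(1 / (4 * √d)) * (‖g‖ ^ 2 - d))) := by
  have hd' : (0 : ℝ) < d := by exact_mod_cast hd
  have h := sq_le_exp_add_exp (1 / (4 * √d) * (‖g‖ ^ 2 - d))
  rw [mul_pow, div_pow, mul_pow, Real.sq_sqrt hd'.le, ← neg_mul] at h
  have h2 := mul_le_mul_of_nonneg_left h (by positivity : (0 : ℝ) ≤ 16 * d)
  calc (‖g‖ ^ 2 - d) ^ 2 = 16 * d * (1 ^ 2 / (4 ^ 2 * d) * (‖g‖ ^ 2 - d) ^ 2) := by
        field_simp; norm_num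
    _ ≤ _ := h2
    _ = _ := by ring

lemma inv_four_sqrt_le (hd : 0 < d) : 1 / (4 * √(d : ℝ)) ≤ 1 / 4 := by
  have : (1 : ℝ) ≤ √d := Real.one_le_sqrt.2 (by exact_mod_cast hd)
  gcongr
  linarith

lemma integrable_chi_sq : Integrable (fun g => (‖g‖ ^ 2 - d) ^ 2) (gauss d) := by
  rcases Nat.eq_zero_or_pos d with rfl | hd
  · have : (fun g : EuclideanSpace ℝ (Fin 0) => (‖g‖ ^ 2 - ((0 : ℕ) : ℝ)) ^ 2) = fun _ => 0 := by
      ext g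
      have : g = 0 := Subsingleton.elim _ _
      simp [this]
    rw [this]
    exact integrable_zero _ _ _
  have h0 := inv_four_sqrt_le hd
  have h1 : 0 ≤ 1 / (4 * √(d : ℝ)) := by positivity
  refine Integrable.mono' ((((integrable_exp_chi (θ := 1 / (4 * √d)) (by linarith)).add
    (integrable_exp_chi (θ := -(1 / (4 * √d))) (by linarith)))).const_mul (32 * (d : ℝ)))
    (by fun_prop) ?_
  filter_upwards with g
  rw [Real.norm_of_nonneg (sq_nonneg _)]
  exact chi_sq_le hd g

/-- A bound of the right order on the variance `2d` of the `χ²_d` law. -/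
lemma integral_chi_sq_le : ∫ g, (‖g‖ ^ 2 - d) ^ 2 ∂(gauss d) ≤ 128 * d := by
  rcases Nat.eq_zero_or_pos d with rfl | hd
  · have (g : EuclideanSpace ℝ (Fin 0)) : g = 0 := Subsingleton.elim _ _
    simp [this]
  have h0 := inv_four_sqrt_le hd
  have h1 : 0 ≤ 1 / (4 * √(d : ℝ)) := by positivity
  have hi1 := integrable_exp_chi (d := d) (θ := 1 / (4 * √d)) (by linarith)
  have hi2 := integrable_exp_chi (d := d) (θ := -(1 / (4 * √d))) (by linarith)
  have hd' : (0 : ℝ) < d := by exact_mod_cast hd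
  have hs : 2 * (d : ℝ) * (1 / (4 * √d)) ^ 2 = 1 / 8 := by
    rw [div_pow, mul_pow, Real.sq_sqrt hd'.le]
    field_simp; norm_num
  have he : Real.exp (1 / 8) ≤ 2 := by
    have := Real.exp_bound_div_one_sub_of_interval (x := 1 / 8) (by norm_num) (by norm_num)
    linarith
  have hb1 := integral_exp_chi_le (d := d) (θ := 1 / (4 * √d)) h0
  have hb2 := integral_exp_chi_le (d := d) (θ := -(1 / (4 * √d))) (by linarith)
  rw [neg_sq, hs] at hb2
  rw [hs] at hb1
  calc _ ≤ ∫ g, 32 * d * (Real.exp (1 / (4 * √d) * (‖g‖ ^ 2 - d)) +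
        Real.exp (-(1 / (4 * √d)) * (‖g‖ ^ 2 - d))) ∂(gauss d) :=
        integral_mono integrable_chi_sq ((hi1.add hi2).const_mul _) (chi_sq_le hd)
    _ ≤ 32 * d * (2 + 2) := by
        rw [integral_const_mul, integral_add hi1 hi2]
        gcongr <;> linarith
    _ = _ := by ring

lemma integral_inner_sq (a : EuclideanSpace ℝ (Fin d)) : ∫ g, ⟪a, g⟫ ^ 2 ∂(gauss d) = ‖a‖ ^ 2 := by
  have h := variance_dual_stdGaussian (innerSL ℝ a)
  rw [variance_of_integral_eq_zero (by fun_prop) (integral_strongDual_stdGaussian _),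
    innerSL_apply_norm] at h
  simpa using h

lemma integrable_inner_sq (a : EuclideanSpace ℝ (Fin d)) :
    Integrable (fun g => ⟪a, g⟫ ^ 2) (gauss d) := by
  have h : MemLp (innerSL ℝ a) 2 (gauss d) := IsGaussian.memLp_dual _ _ _ (by norm_num)
  simpa using h.integrable_sq

lemma integral_inner (a : EuclideanSpace ℝ (Fin d)) : ∫ g, ⟪a, g⟫ ∂(gauss d) = 0 := by
  simpa using integral_strongDual_stdGaussian (innerSL ℝ a)

lemma memLp_chi : MemLp (fun g => ‖g‖ ^ 2 - d) 2 (gauss d) :=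
  (memLp_two_iff_integrable_sq (by fun_prop)).2 integrable_chi_sq

lemma integral_chi : ∫ g, (‖g‖ ^ 2 - d) ∂(gauss d) = 0 := by
  have h (g : EuclideanSpace ℝ (Fin d)) : ‖g‖ ^ 2 - (d : ℝ) =
      ∑ i, (⟪EuclideanSpace.basisFun (Fin d) ℝ i, g⟫ ^ 2 - 1) := by
    rw [Finset.sum_sub_distrib, (EuclideanSpace.basisFun (Fin d) ℝ).sum_sq_inner_right]
    simp
  simp_rw [h]
  rw [integral_finsetSum (f := fun i (g : EuclideanSpace ℝ (Fin d)) =>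
      ⟪EuclideanSpace.basisFun (Fin d) ℝ i, g⟫ ^ 2 - 1) _
    fun i _ => (integrable_inner_sq _).sub (integrable_const _)]
  refine Finset.sum_eq_zero fun i _ => ?_
  rw [integral_sub (integrable_inner_sq _) (integrable_const _), integral_inner_sq]
  simp

/-! ### The noncentral chi-squared law -/

lemma norm_add_sq_sub_eq (a g : EuclideanSpace ℝ (Fin d)) :
    ‖a + g‖ ^ 2 - (d + ‖a‖ ^ 2) = 2 * ⟪a, g⟫ + (‖g‖ ^ 2 - d) := by
  rw [norm_add_sq_real]; ring

lemma memLp_noncentral (a : EuclideanSpace ℝ (Fin d)) :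
    MemLp (fun g => ‖a + g‖ ^ 2 - (d + ‖a‖ ^ 2)) 2 (gauss d) := by
  simp_rw [norm_add_sq_sub_eq]
  exact (((memLp_two_iff_integrable_sq (by fun_prop)).2 (integrable_inner_sq a)).const_mul 2).add
    memLp_chi

lemma integral_noncentral (a : EuclideanSpace ℝ (Fin d)) :
    ∫ g, (‖a + g‖ ^ 2 - (d + ‖a‖ ^ 2)) ∂(gauss d) = 0 := by
  simp_rw [norm_add_sq_sub_eq]
  have h : MemLp (fun g => ⟪a, g⟫) 2 (gauss d) :=
    (memLp_two_iff_integrable_sq (by fun_prop)).2 (integrable_inner_sq a)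
  rw [integral_add ((h.integrable (by norm_num)).const_mul 2)
    (memLp_chi.integrable (by norm_num)), integral_const_mul, integral_inner, integral_chi]
  simp

lemma integral_noncentral_sq_le (a : EuclideanSpace ℝ (Fin d)) :
    ∫ g, (‖a + g‖ ^ 2 - (d + ‖a‖ ^ 2)) ^ 2 ∂(gauss d) ≤ 256 * d + 8 * ‖a‖ ^ 2 := by
  calc _ ≤ ∫ g, (8 * ⟪a, g⟫ ^ 2 + 2 * (‖g‖ ^ 2 - d) ^ 2) ∂(gauss d) := by
        refine integral_mono (memLp_noncentral a).integrable_sq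
          (((integrable_inner_sq a).const_mul 8).add (integrable_chi_sq.const_mul 2)) fun g => ?_
        simp only [norm_add_sq_sub_eq]
        nlinarith [sq_nonneg (2 * ⟪a, g⟫ - (‖g‖ ^ 2 - d))]
    _ ≤ _ := by
        rw [integral_add ((integrable_inner_sq a).const_mul 8) (integrable_chi_sq.const_mul 2),
          integral_const_mul, integral_const_mul, integral_inner_sq]
        linarith [integral_chi_sq_le (d := d)]

end Chi

/-! ### The tail event and the conditional mean -/

section Tail

variable {d : ℕ} {r ρ : ℝ}

lemma mem_tailSet_iff (hr : r ^ 2 = d * ρ) (g : EuclideanSpace ℝ (Fin d)) :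
    g ∈ tailSet d r ↔ d * ρ ≤ ‖g‖ ^ 2 - d := by
  rw [tailSet, Set.mem_ofPred_eq, hr, le_sub_iff_add_le']

/-- A lower bound on the upper tail of `χ²_d`: the Paley–Zygmund inequality for the exponential
`e^{2ρ(‖g‖² - d)}`, whose mean exceeds its value on the boundary of the tail event. -/
lemma le_measureReal_tailSet (h0 : 0 < ρ) (h1 : ρ ≤ 1 / 16) (hr : r ^ 2 = d * ρ)
    (hd : 1 ≤ d * ρ ^ 2) :
    Real.exp (-(24 * (d * ρ ^ 2) + 2)) ≤ (gauss d).real (tailSet d r) := by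
  set B := tailSet d r
  have hB : MeasurableSet B := measurableSet_tailSet d r
  set m := ∫ g, Real.exp (2 * ρ * (‖g‖ ^ 2 - d)) ∂(gauss d) with hm
  set m2 := ∫ g, Real.exp (4 * ρ * (‖g‖ ^ 2 - d)) ∂(gauss d) with hm2
  have hi := integrable_exp_chi (d := d) (θ := 2 * ρ) (by linarith)
  have hi2 := integrable_exp_chi (d := d) (θ := 4 * ρ) (by linarith)
  have hmlow : Real.exp (4 * (d * ρ ^ 2)) ≤ m := by
    refine le_trans (le_of_eq ?_) (le_integral_exp_chi (by linarith) (by linarith))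
    congr 1; ring
  have hm2up : m2 ≤ Real.exp (32 * (d * ρ ^ 2)) := by
    refine (integral_exp_chi_le (by linarith)).trans (le_of_eq ?_)
    congr 1; ring
  have hmpos : 0 < m := (Real.exp_pos _).trans_le hmlow
  have hm2pos : 0 < m2 :=
    (Real.exp_pos _).trans_le (le_integral_exp_chi (by linarith) (by linarith))
  have he : 2 ≤ Real.exp (2 * (d * ρ ^ 2)) := by
    have := Real.add_one_le_exp (2 * (d * ρ ^ 2))
    linarith
  have hbd : Real.exp (2 * (d * ρ ^ 2)) ≤ m / 2 := by
    have : Real.exp (4 * (d * ρ ^ 2)) =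
        Real.exp (2 * (d * ρ ^ 2)) * Real.exp (2 * (d * ρ ^ 2)) := by
      rw [← Real.exp_add]; congr 1; ring
    nlinarith
  -- Off the tail event the exponential is at most half its mean; on it, the arithmetic-geometric
  -- mean inequality with weight `2 m2 / m` replaces the Cauchy–Schwarz inequality.
  have hpt (g : EuclideanSpace ℝ (Fin d)) : Real.exp (2 * ρ * (‖g‖ ^ 2 - d)) ≤
      m / 2 + m2 / m * B.indicator 1 g + m / (4 * m2) * Real.exp (4 * ρ * (‖g‖ ^ 2 - d)) := by
    have hpos := Real.exp_pos (4 * ρ * (‖g‖ ^ 2 - d))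
    by_cases hg : g ∈ B
    · rw [Set.indicator_of_mem hg, Pi.one_apply]
      have hsq : Real.exp (4 * ρ * (‖g‖ ^ 2 - d)) = Real.exp (2 * ρ * (‖g‖ ^ 2 - d)) ^ 2 := by
        rw [← Real.exp_nat_mul]; congr 1; push_cast; ring
      rw [hsq]
      set y := Real.exp (2 * ρ * (‖g‖ ^ 2 - d))
      have : 0 ≤ (m * y - 2 * m2) ^ 2 / (4 * m * m2) := by positivity
      have h3 : (m * y - 2 * m2) ^ 2 / (4 * m * m2) = m2 / m * 1 + m / (4 * m2) * y ^ 2 - y := by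
        field_simp; ring
      linarith
    · rw [Set.indicator_of_notMem hg]
      have h2 : Real.exp (2 * ρ * (‖g‖ ^ 2 - d)) ≤ Real.exp (2 * (d * ρ ^ 2)) := by
        rw [mem_tailSet_iff hr, not_le] at hg
        apply Real.exp_le_exp.2
        nlinarith
      have h3 : 0 ≤ m / (4 * m2) * Real.exp (4 * ρ * (‖g‖ ^ 2 - d)) := by positivity
      linarith
  have hind : Integrable (B.indicator (1 : EuclideanSpace ℝ (Fin d) → ℝ)) (gauss d) :=
    (integrable_const (1 : ℝ)).indicator hB
  have hind2 : Integrable (fun g => m / 2 + m2 / m * B.indicator 1 g) (gauss d) :=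
    (integrable_const (m / 2)).add (hind.const_mul (m2 / m))
  have hint := integral_mono hi (hind2.add (hi2.const_mul (m / (4 * m2)))) hpt
  simp only [Pi.add_apply] at hint
  rw [integral_add hind2 (hi2.const_mul _),
    integral_add (integrable_const _) (hind.const_mul _), integral_const_mul, integral_const_mul,
    integral_indicator_one hB, ← hm, ← hm2, integral_const, probReal_univ, one_smul] at hint
  have h4 : m / (4 * m2) * m2 = m / 4 := by field_simp
  have h5 : m / 4 ≤ m2 / m * (gauss d).real B := by linarith
  have h6 : m ^ 2 / 4 ≤ m2 * (gauss d).real B := by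
    calc m ^ 2 / 4 = m * (m / 4) := by ring
      _ ≤ m * (m2 / m * (gauss d).real B) := by gcongr
      _ = _ := by field_simp
  have h7 : Real.exp (4 * (d * ρ ^ 2)) ^ 2 / 4 ≤
      Real.exp (32 * (d * ρ ^ 2)) * (gauss d).real B := by
    calc _ ≤ m ^ 2 / 4 := by gcongr
      _ ≤ _ := h6
      _ ≤ _ := by gcongr
  have h8 : Real.exp (-2) ≤ 1 / 4 := by
    have := Real.add_one_le_exp (1 : ℝ)
    rw [show (-2 : ℝ) = -(1 + 1) by norm_num, Real.exp_neg, Real.exp_add]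
    rw [inv_le_comm₀ (by positivity) (by norm_num)]
    nlinarith
  refine le_of_mul_le_mul_left ?_ (Real.exp_pos (32 * (d * ρ ^ 2)))
  refine le_trans ?_ h7
  rw [← Real.exp_nat_mul]
  calc _ = Real.exp ((2 : ℕ) * (4 * (d * ρ ^ 2))) * Real.exp (-2) := by
        rw [← Real.exp_add, ← Real.exp_add]; congr 1; push_cast; ring
    _ ≤ Real.exp ((2 : ℕ) * (4 * (d * ρ ^ 2))) * (1 / 4) := by gcongr
    _ = _ := by ring

lemma measureReal_tailSet_pos (h0 : 0 < ρ) (h1 : ρ ≤ 1 / 16) (hr : r ^ 2 = d * ρ)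
    (hd : 1 ≤ d * ρ ^ 2) : 0 < (gauss d).real (tailSet d r) :=
  (Real.exp_pos _).trans_le (le_measureReal_tailSet h0 h1 hr hd)

/-- `α_r(d)` is the conditional mean of `‖g‖²` on the tail event, in centered form. -/
lemma setIntegral_tailSet (hP : 0 < (gauss d).real (tailSet d r)) :
    ∫ g in tailSet d r, (‖g‖ ^ 2 - d) ∂(gauss d) =
      (alpha d r - d) * (gauss d).real (tailSet d r) := by
  have h2 : Integrable (fun g => ‖g‖ ^ 2) (gauss d) := by
    convert! ((memLp_chi (d := d)).integrable (by norm_num)).add (integrable_const (d : ℝ)) using 2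
    simp
  rw [integral_sub h2.integrableOn (integrable_const _), setIntegral_const]
  have : alpha d r = (∫ g in tailSet d r, ‖g‖ ^ 2 ∂(gauss d)) / (gauss d).real (tailSet d r) := rfl
  rw [this, smul_eq_mul]
  field_simp

lemma le_alpha (hP : 0 < (gauss d).real (tailSet d r)) : (d : ℝ) + r ^ 2 ≤ alpha d r := by
  have h := setIntegral_tailSet hP
  have h2 : ∫ g in tailSet d r, r ^ 2 ∂(gauss d) ≤
      ∫ g in tailSet d r, (‖g‖ ^ 2 - d) ∂(gauss d) := by
    refine setIntegral_mono_on (integrable_const _)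
      ((memLp_chi.integrable (by norm_num)).integrableOn) (measurableSet_tailSet d r) fun g hg => ?_
    have : (d : ℝ) + r ^ 2 ≤ ‖g‖ ^ 2 := hg
    linarith
  rw [setIntegral_const, h, smul_eq_mul, mul_comm] at h2
  linarith [le_of_mul_le_mul_right h2 hP]

/-- The conditional mean exceeds `d` by at most a multiple of `r²`. By convexity of the exponential
the conditional mean of `ρ(‖g‖² - d)` is controlled by its exponential moment divided by the
probability of the tail event. -/
lemma alpha_sub_le (h0 : 0 < ρ) (h1 : ρ ≤ 1 / 16) (hr : r ^ 2 = d * ρ) (hd : 1 ≤ d * ρ ^ 2) :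
    alpha d r - d ≤ 28 * r ^ 2 := by
  have hlow := le_measureReal_tailSet h0 h1 hr hd
  have hP := measureReal_tailSet_pos h0 h1 hr hd
  have hα := setIntegral_tailSet hP
  set B := tailSet d r
  -- With this `c`, the bound `e^{2dρ²}` on the exponential moment times `e^{-c}` is the lower bound
  -- `e^{-(24dρ² + 2)}` on the probability of the tail event.
  set c := 26 * (d * ρ ^ 2) + 2 with hc
  have hi := integrable_exp_chi (d := d) (θ := ρ) (by linarith)
  have hchi : Integrable (fun g => ‖g‖ ^ 2 - (d : ℝ)) (gauss d) :=
    memLp_chi.integrable (by norm_num)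
  have hpt (g : EuclideanSpace ℝ (Fin d)) : ρ * (‖g‖ ^ 2 - d) ≤
      (c - 1) + Real.exp (-c) * Real.exp (ρ * (‖g‖ ^ 2 - d)) := by
    have := Real.add_one_le_exp (-c + ρ * (‖g‖ ^ 2 - d))
    rw [Real.exp_add] at this
    linarith
  have h2 : ∫ g in B, ρ * (‖g‖ ^ 2 - d) ∂(gauss d) ≤ ∫ g in B, ((c - 1) + Real.exp (-c) *
      Real.exp (ρ * (‖g‖ ^ 2 - d))) ∂(gauss d) :=
    setIntegral_mono (hchi.const_mul ρ).integrableOn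
      ((integrable_const _).add (hi.const_mul _)).integrableOn hpt
  rw [integral_add (integrable_const _) (hi.const_mul _).integrableOn, integral_const_mul,
    integral_const_mul, setIntegral_const, hα, smul_eq_mul] at h2
  have h3 : ∫ g in B, Real.exp (ρ * (‖g‖ ^ 2 - d)) ∂(gauss d) ≤ Real.exp (2 * d * ρ ^ 2) :=
    (setIntegral_le_integral hi (by filter_upwards with g; positivity)).trans
      (integral_exp_chi_le (by linarith))
  have h4 : Real.exp (-c) * ∫ g in B, Real.exp (ρ * (‖g‖ ^ 2 - d)) ∂(gauss d) ≤
      (gauss d).real B := by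
    refine le_trans ?_ hlow
    calc _ ≤ Real.exp (-c) * Real.exp (2 * d * ρ ^ 2) := by gcongr
      _ = _ := by rw [← Real.exp_add, hc]; congr 1; ring
  have h5 : ρ * (alpha d r - d) * (gauss d).real B ≤ c * (gauss d).real B := by linarith
  have h6 := le_of_mul_le_mul_right h5 hP
  refine le_of_mul_le_mul_left ?_ h0
  rw [hr]
  nlinarith

/-- The truncated second moment of `χ²_d - d`, by Chernoff's method with the exponent `ρ/8`. -/
lemma setIntegral_tailSet_sq_le (h0 : 0 < ρ) (h1 : ρ ≤ 1 / 16) (hr : r ^ 2 = d * ρ) :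
    ∫ g in tailSet d r, (‖g‖ ^ 2 - d) ^ 2 ∂(gauss d) ≤
      512 / ρ ^ 2 * Real.exp (-(d * ρ ^ 2 / 32)) := by
  have hi := integrable_exp_chi (d := d) (θ := ρ / 8) (by linarith)
  have hpt (g) (hg : g ∈ tailSet d r) : (‖g‖ ^ 2 - (d : ℝ)) ^ 2 ≤
      512 / ρ ^ 2 * Real.exp (-(d * ρ ^ 2 / 16)) * Real.exp (ρ / 8 * (‖g‖ ^ 2 - d)) := by
    rw [mem_tailSet_iff hr] at hg
    set x := ‖g‖ ^ 2 - (d : ℝ)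
    have hx : 0 ≤ x := le_trans (by positivity) hg
    have h2 := Real.quadratic_le_exp_of_nonneg (x := ρ / 16 * x) (by positivity)
    have h3 : Real.exp (ρ / 16 * x) ≤
        Real.exp (-(d * ρ ^ 2 / 16)) * Real.exp (ρ / 8 * x) := by
      rw [← Real.exp_add]
      apply Real.exp_le_exp.2
      nlinarith
    have h4 : (ρ / 16 * x) ^ 2 / 2 ≤ Real.exp (-(d * ρ ^ 2 / 16)) * Real.exp (ρ / 8 * x) := by
      have : 0 ≤ ρ / 16 * x := by positivity
      linarith
    calc x ^ 2 = 512 / ρ ^ 2 * ((ρ / 16 * x) ^ 2 / 2) := by field_simp; ring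
      _ ≤ 512 / ρ ^ 2 * (Real.exp (-(d * ρ ^ 2 / 16)) * Real.exp (ρ / 8 * x)) := by gcongr
      _ = _ := by ring
  calc _ ≤ ∫ g in tailSet d r, 512 / ρ ^ 2 * Real.exp (-(d * ρ ^ 2 / 16)) *
        Real.exp (ρ / 8 * (‖g‖ ^ 2 - d)) ∂(gauss d) :=
        setIntegral_mono_on integrable_chi_sq.integrableOn (hi.const_mul _).integrableOn
          (measurableSet_tailSet d r) hpt
    _ ≤ ∫ g, 512 / ρ ^ 2 * Real.exp (-(d * ρ ^ 2 / 16)) *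
        Real.exp (ρ / 8 * (‖g‖ ^ 2 - d)) ∂(gauss d) :=
        setIntegral_le_integral (hi.const_mul _) (by filter_upwards with g; positivity)
    _ ≤ 512 / ρ ^ 2 * Real.exp (-(d * ρ ^ 2 / 16)) * Real.exp (2 * d * (ρ / 8) ^ 2) := by
        rw [integral_const_mul]
        gcongr
        exact integral_exp_chi_le (by linarith)
    _ = _ := by
        rw [mul_assoc, ← Real.exp_add]
        congr 2
        ring

/-! ### The thresholded energy under the null -/

/-- The summand of the test statistic as a function of the observed vector of coefficients of one
coordinate: `(‖g‖² - α_r(d)) 1{‖g‖² ≥ d + r²}`. -/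
noncomputable def thresholded (d : ℕ) (r : ℝ) : EuclideanSpace ℝ (Fin d) → ℝ :=
  (tailSet d r).indicator fun g => ‖g‖ ^ 2 - alpha d r

lemma measurable_thresholded : Measurable (thresholded d r) :=
  Measurable.indicator (by fun_prop) (measurableSet_tailSet d r)

lemma memLp_thresholded : MemLp (thresholded d r) 2 (gauss d) := by
  refine MemLp.indicator (measurableSet_tailSet d r) ?_
  convert! (memLp_chi (d := d)).add (memLp_const (d - alpha d r)) using 2 with g
  simp

lemma integral_thresholded (hP : 0 < (gauss d).real (tailSet d r)) :
    ∫ g, thresholded d r g ∂(gauss d) = 0 := by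
  have h := setIntegral_tailSet hP
  rw [thresholded, integral_indicator (measurableSet_tailSet d r)]
  have h2 (g : EuclideanSpace ℝ (Fin d)) :
      ‖g‖ ^ 2 - alpha d r = (‖g‖ ^ 2 - d) - (alpha d r - d) := by ring
  simp_rw [h2]
  rw [integral_sub (memLp_chi.integrable (by norm_num)).integrableOn (integrable_const _), h,
    setIntegral_const, smul_eq_mul]
  ring

lemma integral_thresholded_sq_le (h0 : 0 < ρ) (h1 : ρ ≤ 1 / 16) (hr : r ^ 2 = d * ρ)
    (hd : 1 ≤ d * ρ ^ 2) :
    ∫ g, thresholded d r g ^ 2 ∂(gauss d) ≤ 512 / ρ ^ 2 * Real.exp (-(d * ρ ^ 2 / 32)) := by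
  have hP := measureReal_tailSet_pos h0 h1 hr hd
  refine le_trans ?_ (setIntegral_tailSet_sq_le h0 h1 hr)
  have h2 : (fun g => thresholded d r g ^ 2) =
      (tailSet d r).indicator fun g => (‖g‖ ^ 2 - alpha d r) ^ 2 := by
    ext g
    by_cases hg : g ∈ tailSet d r <;> simp [thresholded, hg]
  rw [h2, integral_indicator (measurableSet_tailSet d r)]
  -- The second moment about the conditional mean is at most the one about `d`.
  have h3 (g : EuclideanSpace ℝ (Fin d)) : (‖g‖ ^ 2 - alpha d r) ^ 2 =
      (‖g‖ ^ 2 - d) ^ 2 - 2 * (alpha d r - d) * (‖g‖ ^ 2 - d) + (alpha d r - d) ^ 2 := by ring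
  simp_rw [h3]
  have hi1 := (integrable_chi_sq (d := d)).integrableOn (s := tailSet d r)
  have hi2 := (((memLp_chi (d := d)).integrable (by norm_num)).const_mul
    (2 * (alpha d r - d))).integrableOn (s := tailSet d r)
  have hi3 : IntegrableOn (fun g => (‖g‖ ^ 2 - d) ^ 2 - 2 * (alpha d r - d) * (‖g‖ ^ 2 - d))
    (tailSet d r) (gauss d) := hi1.sub hi2
  rw [integral_add hi3 (integrable_const _), integral_sub hi1 hi2, integral_const_mul,
    setIntegral_tailSet hP, setIntegral_const, smul_eq_mul]
  nlinarith [sq_nonneg (alpha d r - d)]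

end Tail

/-! ### The white noise model -/

/-- Chebyshev's inequality for a sum of centered functions of independent standard Gaussian
vectors. -/
lemma measure_le_abs_sum_le {ι Ω : Type*} [Fintype ι] [MeasurableSpace Ω] {P : Measure Ω} {d : ℕ}
    {G : ι → Ω → EuclideanSpace ℝ (Fin d)} (hind : iIndepFun G P) (hG : ∀ j, AEMeasurable (G j) P)
    (hlaw : ∀ j, P.map (G j) = gauss d) {h : ι → EuclideanSpace ℝ (Fin d) → ℝ}
    (hm : ∀ j, Measurable (h j)) (hL : ∀ j, MemLp (h j) 2 (gauss d))
    (h0 : ∀ j, ∫ g, h j g ∂(gauss d) = 0) {t : ℝ} (ht : 0 < t) :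
    P {ω | t ≤ |∑ j, h j (G j ω)|} ≤
      ENNReal.ofReal ((∑ j, ∫ g, h j g ^ 2 ∂(gauss d)) / t ^ 2) := by
  have := hind.isProbabilityMeasure
  set Y : ι → Ω → ℝ := fun j => h j ∘ G j with hY
  have hYL (j) : MemLp (Y j) 2 P :=
    (memLp_map_measure_iff (hm j).aestronglyMeasurable (hG j)).1 (by rw [hlaw]; exact hL j)
  have hY0 (j) : ∫ ω, Y j ω ∂P = 0 := by
    rw [← h0 j, ← hlaw j, integral_map (hG j) (hm j).aestronglyMeasurable]
    rfl
  have hYV (j) : variance (Y j) P = ∫ g, h j g ^ 2 ∂(gauss d) := by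
    rw [variance_of_integral_eq_zero (hYL j).1.aemeasurable (hY0 j), ← hlaw j,
      integral_map (hG j) ((hm j).pow_const 2).aestronglyMeasurable]
    rfl
  have hsum : ∫ ω, (∑ j, Y j) ω ∂P = 0 := by
    simp_rw [Finset.sum_apply]
    rw [integral_finsetSum _ fun j _ => (hYL j).integrable (by norm_num)]
    exact Finset.sum_eq_zero fun j _ => hY0 j
  have hvar : variance (∑ j, Y j) P = ∑ j, ∫ g, h j g ^ 2 ∂(gauss d) := by
    rw [IndepFun.variance_sum (fun j _ => hYL j) fun i _ j _ hij =>
      (hind.indepFun hij).comp (hm i) (hm j)]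
    exact Finset.sum_congr rfl fun j _ => hYV j
  have h1 := meas_ge_le_variance_div_sq (memLp_finsetSum' univ fun j _ => hYL j) ht
  rw [hsum, hvar] at h1
  simpa [hY] using h1

section Model

variable {p : ℕ} {Ω : Type*} {W : L2Cube p → Ω → ℝ} {ψ : ℕ → I → ℝ}

/-- The noise in the first `d` coefficients of the `j`-th coordinate, rescaled to unit variance. -/
noncomputable def noiseVec (ψ : ℕ → I → ℝ) (hψ : ∀ k, MemLp (ψ k) 2 (volume : Measure I))
    (W : L2Cube p → Ω → ℝ) (d : ℕ) (j : Fin p) (ω : Ω) : EuclideanSpace ℝ (Fin d) :=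
  WithLp.toLp 2 fun k => W (coordFun (ψ k) (hψ k) j) ω

/-- The first `d` coefficients of the signal `f` on the `j`-th coordinate, in units of the noise
level. -/
noncomputable def signalVec (n : ℕ) (ψ : ℕ → I → ℝ)
    (hψ : ∀ k, MemLp (ψ k) 2 (volume : Measure I)) (f : L2Cube p) (d : ℕ) (j : Fin p) :
    EuclideanSpace ℝ (Fin d) :=
  WithLp.toLp 2 fun k => √n * ⟪f, coordFun (ψ k) (hψ k) j⟫

lemma energy_eq_norm_sq {n : ℕ} (hn : 1 ≤ n) (hψ : ∀ k, MemLp (ψ k) 2 (volume : Measure I))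
    (f : L2Cube p) (d : ℕ) (j : Fin p) (ω : Ω) :
    energy n d (sequenceData n ψ hψ W f ω) j =
      ‖signalVec n ψ hψ f d j + noiseVec ψ hψ W d j ω‖ ^ 2 := by
  have hn' : (0 : ℝ) < n := by exact_mod_cast hn
  rw [EuclideanSpace.real_norm_sq_eq, energy, Finset.sum_range, Finset.mul_sum]
  refine Finset.sum_congr rfl fun k _ => ?_
  simp only [sequenceData, whiteNoiseModel, signalVec, noiseVec, PiLp.add_apply]
  have h (x : ℝ) : n * x ^ 2 = (√n * x) ^ 2 := by rw [mul_pow, Real.sq_sqrt hn'.le]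
  rw [h]
  congr 1
  have : √(n : ℝ) ≠ 0 := by positivity
  field_simp

lemma norm_signalVec_sq (n : ℕ) (hψ : ∀ k, MemLp (ψ k) 2 (volume : Measure I))
    (f : L2Cube p) (d : ℕ) (j : Fin p) :
    ‖signalVec n ψ hψ f d j‖ ^ 2 = n * ∑ k ∈ range d, ⟪f, coordFun (ψ k) (hψ k) j⟫ ^ 2 := by
  rw [EuclideanSpace.real_norm_sq_eq, Finset.sum_range, Finset.mul_sum]
  refine Finset.sum_congr rfl fun k _ => ?_
  simp only [signalVec, mul_pow, Real.sq_sqrt (Nat.cast_nonneg n)]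

lemma signalVec_eq_zero {n : ℕ} {hψ : ∀ k, MemLp (ψ k) 2 (volume : Measure I)}
    {f : L2Cube p} {j : Fin p} (h : ∀ k, ⟪f, coordFun (ψ k) (hψ k) j⟫ = 0) (d : ℕ) :
    signalVec n ψ hψ f d j = 0 := by
  ext k
  simp [signalVec, h]

lemma testStatistic_eq_sum {n : ℕ} (hn : 1 ≤ n) (hψ : ∀ k, MemLp (ψ k) 2 (volume : Measure I))
    (f : L2Cube p) (d : ℕ) (r : ℝ) (ω : Ω) :
    testStatistic n d r (sequenceData n ψ hψ W f ω) =
      ∑ j, thresholded d r (signalVec n ψ hψ f d j + noiseVec ψ hψ W d j ω) := by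
  classical
  refine Finset.sum_congr rfl fun j _ => ?_
  rw [energy_eq_norm_sq hn, thresholded, Set.indicator_apply]
  rfl

variable [MeasurableSpace Ω] {P : Measure Ω} {H : Type*} [NormedAddCommGroup H]
  [InnerProductSpace ℝ H] [CompleteSpace H] [RKHS ℝ H I ℝ] {μ : ℕ → ℝ}

lemma aemeasurable_noiseVec (hW : IsWhiteNoise W P) (hψ : ∀ k, MemLp (ψ k) 2 (volume : Measure I))
    (d : ℕ) (j : Fin p) : AEMeasurable (noiseVec ψ hψ W d j) P := by
  have h : AEMeasurable (fun ω (k : Fin d) => W (coordFun (ψ k) (hψ k) j) ω) P :=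
    aemeasurable_pi_lambda _ fun k => hW.isGaussianProcess.aemeasurable _
  have h2 : Measurable (WithLp.toLp 2 : (Fin d → ℝ) → EuclideanSpace ℝ (Fin d)) := by fun_prop
  exact h2.comp_aemeasurable h

/-- The noise vectors of distinct coordinates are independent, as `φ_{j,k}` and `φ_{i,l}` are
orthogonal for `i ≠ j`. -/
lemma iIndepFun_noiseVec (hψ : IsEigensystem H μ ψ) (hW : IsWhiteNoise W P) (d : ℕ) :
    iIndepFun (noiseVec ψ hψ.memLp W d) P := by
  have h := IsGaussianProcess.iIndepFun_of_covariance_eq_zero (P := P)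
    (X := fun (j : Fin p) (k : Fin d) ω => W (coordFun (ψ k) (hψ.memLp k) j) ω)
    (hW.isGaussianProcess.comp_right
      fun q : (_ : Fin p) × Fin d => coordFun (ψ q.2) (hψ.memLp q.2) q.1)
    (fun j k => hW.isGaussianProcess.aemeasurable _)
    (fun i j hij k l => by
      have := hW.covariance (coordFun (ψ k) (hψ.memLp k) i) (coordFun (ψ l) (hψ.memLp l) j)
      rwa [hψ.inner_coordFun_eq_ite, if_neg (by tauto)] at this)
  exact h.comp (fun _ => WithLp.toLp 2) fun _ => by fun_prop

lemma map_noiseVec (hψ : IsEigensystem H μ ψ) (hW : IsWhiteNoise W P) (d : ℕ) (j : Fin p) :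
    P.map (noiseVec ψ hψ.memLp W d j) = gauss d := by
  have := hW.isGaussianProcess.isProbabilityMeasure
  set Z : Fin d → Ω → ℝ := fun k => W (coordFun (ψ k) (hψ.memLp k) j) with hZ
  have hm (k) : AEMeasurable (Z k) P := hW.isGaussianProcess.aemeasurable _
  have hcov (k l) : cov[Z k, Z l; P] = if k = l then 1 else 0 := by
    have := hW.covariance (coordFun (ψ k) (hψ.memLp k) j) (coordFun (ψ l) (hψ.memLp l) j)
    rw [hψ.inner_coordFun_eq_ite] at this
    simpa [Fin.ext_iff] using this
  have h := IsGaussianProcess.iIndepFun_of_covariance_eq_zero (P := P)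
    (X := fun (k : Fin d) (_ : Unit) ω => Z k ω)
    (hW.isGaussianProcess.comp_right
      fun q : (_ : Fin d) × Unit => coordFun (ψ q.1) (hψ.memLp q.1) j)
    (fun k _ => hm k) (fun k l hkl _ _ => by
      have := hcov k l
      rwa [if_neg hkl] at this)
  have hind : iIndepFun Z P := h.comp (fun _ x => x ()) fun _ => measurable_pi_apply _
  have hlaw (k) : P.map (Z k) = gaussianReal 0 1 := by
    rw [(hW.isGaussianProcess.hasGaussianLaw_eval _).map_eq_gaussianReal, hW.mean_zero,
      ← covariance_self (hm k), hcov, if_pos rfl]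
    simp
  have hpi := (iIndepFun_iff_map_fun_eq_pi_map hm).1 hind
  simp_rw [hlaw] at hpi
  rw [gauss, ← map_pi_eq_stdGaussian, ← hpi, AEMeasurable.map_map_of_aemeasurable (by fun_prop)
    (aemeasurable_pi_lambda _ hm)]
  rfl

/-- The type I error, by Chebyshev's inequality. -/
lemma measure_lt_testStatistic_null_le (hψ : IsEigensystem H μ ψ) (hW : IsWhiteNoise W P) {n : ℕ}
    (hn : 1 ≤ n) {d : ℕ} {r v t : ℝ} (hP : 0 < (gauss d).real (tailSet d r))
    (hv : p * ∫ g, thresholded d r g ^ 2 ∂(gauss d) ≤ v) (ht : 0 < t) :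
    P {ω | t < testStatistic n d r (sequenceData n ψ hψ.memLp W 0 ω)} ≤
      ENNReal.ofReal (v / t ^ 2) := by
  refine le_trans (measure_mono ?_) ((measure_le_abs_sum_le (iIndepFun_noiseVec hψ hW d)
    (aemeasurable_noiseVec hW hψ.memLp d) (map_noiseVec hψ hW d)
    (h := fun _ => thresholded d r) (fun _ => measurable_thresholded) (fun _ => memLp_thresholded)
    (fun _ => integral_thresholded hP) ht).trans (ENNReal.ofReal_le_ofReal ?_))
  · intro ω hω
    rw [Set.mem_ofPred_eq, testStatistic_eq_sum hn] at hω
    simp_rw [signalVec_eq_zero (n := n) (hψ := hψ.memLp) (f := (0 : L2Cube p))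
      (fun k => inner_zero_left _), zero_add] at hω
    exact (hω.trans_le (le_abs_self _)).le
  · rw [Finset.sum_const, card_univ, Fintype.card_fin, nsmul_eq_mul]
    gcongr

/-- The type II error at a signal supported on the coordinates in `S`, with total energy
`∑_{j ∈ S} ‖a_j‖²`. On `S` the thresholded summand dominates the unthresholded `E_j - α_r(d)`,
because `α_r(d)` is at least the threshold; so Chebyshev's inequality applies to a sum whose mean
and variance are explicit. -/
lemma measure_testStatistic_le_le (hψ : IsEigensystem H μ ψ) (hW : IsWhiteNoise W P) {n : ℕ}
    (hn : 1 ≤ n) {d : ℕ} {r v t : ℝ} (hP : 0 < (gauss d).real (tailSet d r))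
    (hv : p * ∫ g, thresholded d r g ^ 2 ∂(gauss d) ≤ v) {f : L2Cube p} {S : Finset (Fin p)}
    (hS : ∀ j ∉ S, ∀ k, ⟪f, coordFun (ψ k) (hψ.memLp k) j⟫ = 0)
    {Λ : ℝ} (hΛ : Λ = ∑ j ∈ S, ‖signalVec n ψ hψ.memLp f d j‖ ^ 2) (hΛ0 : 0 < Λ)
    (ht : t + S.card * (alpha d r - d) ≤ Λ / 2) :
    P {ω | testStatistic n d r (sequenceData n ψ hψ.memLp W f ω) ≤ t} ≤
      ENNReal.ofReal ((256 * S.card * d + 8 * Λ + v) / (Λ / 2) ^ 2) := by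
  classical
  set a := signalVec n ψ hψ.memLp f d with ha
  let h (j : Fin p) : EuclideanSpace ℝ (Fin d) → ℝ :=
    if j ∈ S then fun g => ‖a j + g‖ ^ 2 - (d + ‖a j‖ ^ 2) else thresholded d r
  have hv0 : 0 ≤ ∫ g, thresholded d r g ^ 2 ∂(gauss d) := integral_nonneg fun _ => sq_nonneg _
  refine le_trans (measure_mono ?_) ((measure_le_abs_sum_le (iIndepFun_noiseVec hψ hW d)
    (aemeasurable_noiseVec hW hψ.memLp d) (map_noiseVec hψ hW d) (h := h) ?_ ?_ ?_
    (half_pos hΛ0)).trans (ENNReal.ofReal_le_ofReal ?_))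
  · intro ω hω
    rw [Set.mem_ofPred_eq, testStatistic_eq_sum hn] at hω
    have hle (j) : h j (noiseVec ψ hψ.memLp W d j ω) +
        (if j ∈ S then ‖a j‖ ^ 2 - (alpha d r - d) else 0) ≤
          thresholded d r (a j + noiseVec ψ hψ.memLp W d j ω) := by
      by_cases hj : j ∈ S
      · simp only [h, if_pos hj]
        set y := a j + noiseVec ψ hψ.memLp W d j ω
        by_cases hy : y ∈ tailSet d r
        · rw [thresholded, Set.indicator_of_mem hy]
          linarith
        · rw [thresholded, Set.indicator_of_notMem hy]
          have h1 := le_alpha hP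
          have h2 : ¬ (d : ℝ) + r ^ 2 ≤ ‖y‖ ^ 2 := hy
          linarith
      · simp only [h, if_neg hj, add_zero]
        rw [ha, signalVec_eq_zero (hS j hj), zero_add]
    have hsum := Finset.sum_le_sum fun j (_ : j ∈ (univ : Finset (Fin p))) => hle j
    rw [Finset.sum_add_distrib, Finset.sum_ite_mem, Finset.univ_inter, Finset.sum_sub_distrib,
      Finset.sum_const, nsmul_eq_mul, ← hΛ] at hsum
    rw [Set.mem_ofPred_eq]
    refine le_trans ?_ (neg_le_abs _)
    linarith
  · intro j
    by_cases hj : j ∈ S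
    · simp only [h, if_pos hj]; fun_prop
    · simp only [h, if_neg hj]; exact measurable_thresholded
  · intro j
    by_cases hj : j ∈ S
    · simp only [h, if_pos hj]; exact memLp_noncentral _
    · simp only [h, if_neg hj]; exact memLp_thresholded
  · intro j
    by_cases hj : j ∈ S
    · simp only [h, if_pos hj]; exact integral_noncentral _
    · simp only [h, if_neg hj]; exact integral_thresholded hP
  · have hj (j) : ∫ g, h j g ^ 2 ∂(gauss d) ≤ (if j ∈ S then 256 * d + 8 * ‖a j‖ ^ 2 else 0) +
        ∫ g, thresholded d r g ^ 2 ∂(gauss d) := by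
      by_cases hj : j ∈ S
      · simp only [h, if_pos hj]
        linarith [integral_noncentral_sq_le (a j)]
      · simp only [h, if_neg hj]
        linarith
    have hsum := Finset.sum_le_sum fun j (_ : j ∈ (univ : Finset (Fin p))) => hj j
    rw [Finset.sum_add_distrib, Finset.sum_ite_mem, Finset.univ_inter, Finset.sum_add_distrib,
      Finset.sum_const, Finset.sum_const, nsmul_eq_mul, nsmul_eq_mul, ← Finset.mul_sum, ← hΛ,
      card_univ, Fintype.card_fin] at hsum
    gcongr
    linarith

end Model

/-! ### Rates and the risk bound -/

section Rates

lemma half_le_logFactor {p s : ℕ} (hs : 1 ≤ s) (hsp : (s : ℝ) < √(p : ℝ)) :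
    1 / 2 ≤ logFactor p s := by
  have hs' : (0 : ℝ) < s := by exact_mod_cast hs
  have h1 : (s : ℝ) ^ 2 < p := (Real.lt_sqrt hs'.le).1 hsp
  have h2 : 1 ≤ (p : ℝ) / (s : ℝ) ^ 2 := by rw [le_div_iff₀ (by positivity)]; linarith
  have h3 : Real.log 2 ≤ logFactor p s := Real.log_le_log (by norm_num) (by linarith)
  linarith [Real.log_two_gt_d9]

/-- The sparsity factor is chosen so that `p` is comparable to `s² e^L`. -/
lemma le_sq_mul_exp_logFactor {p s : ℕ} (hs : 1 ≤ s) :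
    (p : ℝ) ≤ s ^ 2 * Real.exp (logFactor p s) := by
  have hs' : (0 : ℝ) < s := by exact_mod_cast hs
  rw [logFactor, Real.exp_log (by positivity)]
  have : (s : ℝ) ^ 2 * (1 + p / s ^ 2) = s ^ 2 + p := by field_simp
  nlinarith [sq_nonneg (s : ℝ)]

lemma truncationOrder_spec {μ : ℕ → ℝ} (hμ : ∀ k, μ k ≤ 1) {p s n : ℕ} (hn : 1 ≤ n)
    (hL : 0 < logFactor p s) :
    1 ≤ truncationOrder μ p s n ∧ μ (truncationOrder μ p s n - 1) ≤
      √((truncationOrder μ p s n : ℝ) * logFactor p s) / n := by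
  have hn' : (0 : ℝ) < n := by exact_mod_cast hn
  refine Nat.sInf_mem (s := {ν : ℕ | 1 ≤ ν ∧ μ (ν - 1) ≤ √((ν : ℝ) * logFactor p s) / n}) ?_
  obtain ⟨m, hm⟩ := exists_nat_ge ((n : ℝ) ^ 2 / logFactor p s)
  refine ⟨max 1 m, le_max_left _ _, (hμ _).trans ?_⟩
  rw [le_div_iff₀ hn', one_mul]
  apply Real.le_sqrt_of_sq_le
  rw [div_le_iff₀ hL] at hm
  refine hm.trans ?_
  gcongr
  exact le_max_right _ _

lemma radius_sq {x : ℝ} (hx : 0 ≤ x) : (3 * x ^ (1 / 4 : ℝ)) ^ 2 = 9 * √x := by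
  rw [mul_pow, ← Real.rpow_natCast (x ^ (1 / 4 : ℝ)), ← Real.rpow_mul hx, Real.sqrt_eq_rpow]
  norm_num

/-- In the bulk regime `log(1 + p/s²) ≲ d` the squared radius is a small multiple `ρ` of `d`. -/
lemma exists_radius_ratio {d : ℕ} {L : ℝ} (hL : 1 / 2 ≤ L) (hLd : L ≤ (1 / 144) ^ 2 * d) :
    ∃ ρ : ℝ, 0 < ρ ∧ ρ ≤ 1 / 16 ∧ (3 * (d * L) ^ (1 / 4 : ℝ)) ^ 2 = d * ρ ∧
      d * ρ ^ 2 = 81 * L := by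
  have hd : (0 : ℝ) < d := by linarith
  refine ⟨9 * √(L / d), by positivity, ?_, ?_, ?_⟩
  · have : √(L / d) ≤ 1 / 144 := by
      apply Real.sqrt_le_iff.2 ⟨by norm_num, ?_⟩
      rw [div_le_iff₀ hd]
      exact hLd
    linarith
  · rw [radius_sq (by positivity)]
    have : √(d * L) = d * √(L / d) := by
      rw [show d * L = d ^ 2 * (L / d) by field_simp, Real.sqrt_mul (by positivity),
        Real.sqrt_sq hd.le]
    rw [this]; ring
  · rw [mul_pow, Real.sq_sqrt (by positivity)]
    field_simp; norm_num

/-- The null variance of the test statistic: the exponentially small probability of exceeding the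
threshold compensates the number `p` of coordinates. -/
lemma mul_integral_thresholded_sq_le {p s d : ℕ} (hs : 1 ≤ s) (hsp : (s : ℝ) < √(p : ℝ))
    (hLd : logFactor p s ≤ (1 / 144) ^ 2 * d) :
    p * ∫ g, thresholded d (3 * (d * logFactor p s) ^ (1 / 4 : ℝ)) g ^ 2 ∂(gauss d) ≤
      26 * (s ^ 2 * (d * logFactor p s)) := by
  have hL := half_le_logFactor hs hsp
  have hp := le_sq_mul_exp_logFactor (p := p) hs
  set L := logFactor p s
  have hd : (0 : ℝ) < d := by linarith
  obtain ⟨ρ, h0, h1, hr, hρ⟩ := exists_radius_ratio hL hLd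
  have h2 := integral_thresholded_sq_le h0 h1 hr (by linarith)
  have h3 : 512 / ρ ^ 2 ≤ 26 * (d * L) := by
    rw [div_le_iff₀ (by positivity)]
    nlinarith
  calc _ ≤ s ^ 2 * Real.exp L * (26 * (d * L) * Real.exp (-(d * ρ ^ 2 / 32))) := by
        refine mul_le_mul hp (h2.trans ?_) (integral_nonneg fun _ => sq_nonneg _) (by positivity)
        gcongr
    _ = 26 * (s ^ 2 * (d * L)) * Real.exp (L - d * ρ ^ 2 / 32) := by
        rw [sub_eq_add_neg, Real.exp_add]; ring
    _ ≤ 26 * (s ^ 2 * (d * L)) * 1 := by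
        gcongr
        apply Real.exp_le_one_iff.2
        rw [hρ]; linarith
    _ = _ := mul_one _

/-- The type II error bound of Chebyshev's inequality in terms of the ratio `C` of the signal size
to the rate. -/
lemma chebyshev_ratio_le {C Q q Λ x : ℝ} (hC : 600 * Q ≤ C) (hQ : 1 ≤ Q) (hq : 1 / 2 ≤ q)
    (hΛ : C * q ≤ Λ) (hx : x ≤ 2 * Q * q ^ 2) :
    (256 * x + 8 * Λ + 26 * Q * q ^ 2) / (Λ / 2) ^ 2 ≤ 2216 * Q / C := by
  have hC1 : 1 ≤ C := by linarith
  have hΛC : C ≤ 2 * Λ := by nlinarith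
  have hΛ0 : 0 < Λ := by linarith
  have h2 : 256 * x + 8 * Λ + 26 * Q * q ^ 2 ≤ 538 * (Q * q ^ 2) + 8 * Λ := by linarith
  refine (div_le_div_of_nonneg_right h2 (by positivity)).trans ?_
  rw [div_le_div_iff₀ (by positivity) (by linarith)]
  have h3 : C * q ^ 2 ≤ Λ ^ 2 := by
    calc C * q ^ 2 ≤ C ^ 2 * q ^ 2 :=
          mul_le_mul_of_nonneg_right (le_self_pow₀ hC1 two_ne_zero) (sq_nonneg q)
      _ = (C * q) ^ 2 := by ring
      _ ≤ _ := pow_le_pow_left₀ (by positivity) hΛ 2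
  have h5 : Λ * C ≤ Q * (2 * Λ ^ 2) := by
    calc Λ * C ≤ Λ * (2 * Λ) := mul_le_mul_of_nonneg_left hΛC hΛ0.le
      _ = 1 * (2 * Λ ^ 2) := by ring
      _ ≤ _ := mul_le_mul_of_nonneg_right hQ (by positivity)
  have h6 : Q * (C * q ^ 2) ≤ Q * Λ ^ 2 := mul_le_mul_of_nonneg_left h3 (by linarith)
  linarith

end Rates

/-- The total risk bound with explicit constants, `q = s √(ν log(1 + p/s²)) = n τ²` being the signal
strength. -/
lemma totalRisk_le {H : Type u} [NormedAddCommGroup H] [InnerProductSpace ℝ H] [CompleteSpace H]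
    [RKHS ℝ H I ℝ] (hc : IsCentered H) {μ : ℕ → ℝ} {ψ : ℕ → I → ℝ} (hψ : IsEigensystem H μ ψ)
    {p s n : ℕ} (hn : 1 ≤ n) (hs : 1 ≤ s) (hsp : (s : ℝ) < √(p : ℝ)) {D : ℝ} (hD : 1 ≤ D)
    (hLd : logFactor p s ≤ (1 / 144) ^ 2 * (testOrder D μ p s n : ℝ))
    {Ω : Type v} [MeasurableSpace Ω] {P : Measure Ω} {W : L2Cube p → Ω → ℝ}
    (hW : IsWhiteNoise W P) {C : ℝ} (hC : 600 * (⌈D⌉₊ : ℝ) ≤ C) :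
    totalRisk H P W s n (testOrder D μ p s n) ψ hψ.memLp
        (3 * ((testOrder D μ p s n : ℝ) * logFactor p s) ^ (1 / 4 : ℝ))
        (C * 1 * n * bulkRate μ p s n ^ 2) (C * bulkRate μ p s n) ≤
      ENNReal.ofReal (2300 * ⌈D⌉₊ / C) := by
  have hL := half_le_logFactor hs hsp
  have hnull := mul_integral_thresholded_sq_le hs hsp hLd
  obtain ⟨ρ, h0, h1, hr, hρ⟩ := exists_radius_ratio hL hLd
  have hμ (k : ℕ) : μ k ≤ 1 := hψ.top_eq_one ▸ hψ.antitone (Nat.zero_le k)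
  obtain ⟨hν1, hμν⟩ := truncationOrder_spec hμ hn (by linarith : 0 < logFactor p s)
  rw [bulkRate]
  set L := logFactor p s with hLdef
  set ν := truncationOrder μ p s n with hνdef
  have hdef : testOrder D μ p s n = max ν ⌈D⌉₊ := rfl
  set d := testOrder D μ p s n with hddef
  set Q : ℝ := (⌈D⌉₊ : ℝ) with hQdef
  set r := 3 * ((d : ℝ) * L) ^ (1 / 4 : ℝ) with hrdef
  have hP := measureReal_tailSet_pos h0 h1 hr (by linarith)
  have hn' : (0 : ℝ) < n := by exact_mod_cast hn
  have hs' : (1 : ℝ) ≤ s := by exact_mod_cast hs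
  have hν' : (1 : ℝ) ≤ ν := by exact_mod_cast hν1
  have hQ1 : 1 ≤ Q := hD.trans (Nat.le_ceil D)
  have hdQ : (d : ℝ) ≤ Q * ν := by
    rw [hdef, Nat.cast_max]
    exact max_le (by nlinarith) (by nlinarith)
  have hνd : ν ≤ d := hdef ▸ le_max_left _ _
  set w := √(ν * L) with hw
  have hw2 : w ^ 2 = ν * L := Real.sq_sqrt (by positivity)
  have hwhalf : 1 / 2 ≤ w := by
    apply Real.le_sqrt_of_sq_le
    nlinarith
  set q := (s : ℝ) * w with hq
  have hqhalf : 1 / 2 ≤ q := by nlinarith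
  have hq0 : 0 < q := by linarith
  have hC0 : 600 ≤ C := by linarith
  have hτ2 : √(q / n) ^ 2 = q / n := Real.sq_sqrt (by positivity)
  have hthr : C * 1 * n * √(q / n) ^ 2 = C * q := by rw [hτ2]; field_simp
  rw [hthr]
  have hv : p * ∫ g, thresholded d r g ^ 2 ∂(gauss d) ≤ 26 * Q * q ^ 2 := by
    refine hnull.trans ?_
    calc 26 * ((s : ℝ) ^ 2 * (d * L)) ≤ 26 * ((s : ℝ) ^ 2 * (Q * ν * L)) := by gcongr
      _ = 26 * Q * (s ^ 2 * (ν * L)) := by ring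
      _ = _ := by rw [← hw2, hq]; ring
  have hI := measure_lt_testStatistic_null_le hψ hW hn (d := d) (r := r) hP hv
    (by positivity : 0 < C * q)
  have hII : (⨆ f ∈ {f : L2Cube p | f ∈ signalClass H p s ∧ C * √(q / n) ≤ ‖f‖},
      P {ω | testStatistic n d r (sequenceData n ψ hψ.memLp W f ω) ≤ C * q}) ≤
        ENNReal.ofReal (2216 * Q / C) := by
    refine iSup₂_le fun f hf => ?_
    obtain ⟨hf, hfn⟩ := hf
    obtain ⟨S, hSs, hS0, hSf⟩ := hψ.exists_support hc hf d
    set Λ := ∑ j ∈ S, ‖signalVec n ψ hψ.memLp f d j‖ ^ 2 with hΛ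
    have hSs' : (S.card : ℝ) ≤ s := by exact_mod_cast hSs
    have hbias : n * (s * μ d) ≤ q := by
      have h2 : μ d ≤ w / n := (hψ.antitone (by omega)).trans hμν
      calc n * (s * μ d) ≤ n * (s * (w / n)) := by gcongr
        _ = q := by rw [hq]; field_simp
    have hΛlow : (C ^ 2 - 1) * q ≤ Λ := by
      have h2 : Λ = n * ∑ j ∈ S, ∑ k ∈ range d, ⟪f, coordFun (ψ k) (hψ.memLp k) j⟫ ^ 2 := by
        rw [hΛ, Finset.mul_sum]
        exact Finset.sum_congr rfl fun j _ => norm_signalVec_sq n hψ.memLp f d j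
      have h3 : C ^ 2 * (q / n) ≤ ‖f‖ ^ 2 := by
        rw [← hτ2, ← mul_pow]
        gcongr
      have h4 : C ^ 2 * q ≤ n * ‖f‖ ^ 2 := by
        calc C ^ 2 * q = n * (C ^ 2 * (q / n)) := by field_simp
          _ ≤ _ := by gcongr
      have h5 := mul_le_mul_of_nonneg_left hSf hn'.le
      rw [← h2, mul_sub] at h5
      linarith
    have hα : S.card * (alpha d r - d) ≤ 252 * Q * q := by
      have h2 := alpha_sub_le h0 h1 hr (by linarith)
      have h3 : r ^ 2 ≤ 9 * (Q * w) := by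
        rw [hrdef, radius_sq (by positivity)]
        gcongr
        apply Real.sqrt_le_iff.2 ⟨by positivity, ?_⟩
        rw [mul_pow, hw2]
        calc (d : ℝ) * L ≤ Q * ν * L := by gcongr
          _ = Q * (ν * L) := by ring
          _ ≤ Q ^ 2 * (ν * L) := by gcongr; exact le_self_pow₀ hQ1 two_ne_zero
      have h4 : 0 ≤ alpha d r - d := by linarith [le_alpha hP, sq_nonneg r]
      calc S.card * (alpha d r - d) ≤ s * (28 * (9 * (Q * w))) := by
            gcongr
            linarith
        _ = _ := by rw [hq]; ring
    have hCC : 600 * C ≤ C ^ 2 := by rw [sq]; exact mul_le_mul_of_nonneg_right hC0 (by linarith)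
    have hCq : C * q ≤ Λ :=
      (mul_le_mul_of_nonneg_right (by linarith : C ≤ C ^ 2 - 1) hq0.le).trans hΛlow
    have hΛ0 : 0 < Λ := lt_of_lt_of_le (by positivity) hCq
    refine (measure_testStatistic_le_le hψ hW hn hP hv hS0 hΛ hΛ0 ?_).trans
      (ENNReal.ofReal_le_ofReal ?_)
    · have := (mul_le_mul_of_nonneg_right
        (by linarith : 2 * (C + 252 * Q) ≤ C ^ 2 - 1) hq0.le).trans hΛlow
      linarith
    · have hsd : S.card * (d : ℝ) ≤ 2 * Q * q ^ 2 := by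
        calc S.card * (d : ℝ) ≤ s * (Q * ν) := by gcongr
          _ = s * (Q * (ν * 1)) := by ring
          _ ≤ s ^ 2 * (Q * (ν * (2 * L))) := by
              gcongr
              · exact le_self_pow₀ hs' two_ne_zero
              · linarith
          _ = 2 * Q * (s ^ 2 * (ν * L)) := by ring
          _ = _ := by rw [← hw2, hq]; ring
      rw [mul_assoc 256]
      exact chebyshev_ratio_le hC hQ1 hqhalf hCq hsd
  have hI2 : 26 * Q * q ^ 2 / (C * q) ^ 2 ≤ 26 * Q / C := by
    rw [div_le_div_iff₀ (by positivity) (by linarith)]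
    have : C * q ^ 2 ≤ (C * q) ^ 2 := by
      rw [mul_pow C q]; gcongr; exact le_self_pow₀ (by linarith) two_ne_zero
    calc 26 * Q * q ^ 2 * C = 26 * Q * (C * q ^ 2) := by ring
      _ ≤ _ := by gcongr
  rw [totalRisk]
  refine (add_le_add (hI.trans (ENNReal.ofReal_le_ofReal hI2)) hII).trans ?_
  rw [← ENNReal.ofReal_add (by positivity) (by positivity)]
  apply ENNReal.ofReal_le_ofReal
  rw [← add_div]
  gcongr
  linarith

end SparseAdditive

theorem mainTheorem2 :
    ∃ D₀ : ℝ, 0 < D₀ ∧ ∀ D : ℝ, D₀ ≤ D →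
    ∃ K₁ K₂ K₃ : ℝ, 0 < K₁ ∧ 0 < K₂ ∧ 0 < K₃ ∧
    ∀ η : ℝ, 0 < η → η < 1 →
    ∃ Cη : ℝ, 0 < Cη ∧
    ∀ (H : Type u) [NormedAddCommGroup H] [InnerProductSpace ℝ H] [CompleteSpace H]
      [RKHS ℝ H unitInterval ℝ] (_ : SparseAdditive.IsCentered H)
      (μ : ℕ → ℝ) (ψ : ℕ → unitInterval → ℝ) (hψ : SparseAdditive.IsEigensystem H μ ψ)
      (p s n : ℕ), 1 ≤ n → 1 ≤ s → (s : ℝ) < √(p : ℝ) →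
      SparseAdditive.logFactor p s ≤ K₃ ^ 2 * (SparseAdditive.testOrder D μ p s n : ℝ) →
    ∀ (Ω : Type v) [MeasurableSpace Ω] (P : MeasureTheory.Measure Ω)
      (W : SparseAdditive.L2Cube p → Ω → ℝ), SparseAdditive.IsWhiteNoise W P →
    ∀ C : ℝ, Cη < C →
      SparseAdditive.totalRisk H P W s n (SparseAdditive.testOrder D μ p s n) ψ hψ.memLp
        (K₂ * ((SparseAdditive.testOrder D μ p s n : ℝ) * SparseAdditive.logFactor p s)
          ^ (1 / 4 : ℝ))
        (C * K₁ * n * SparseAdditive.bulkRate μ p s n ^ 2)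
        (C * SparseAdditive.bulkRate μ p s n)
      ≤ ENNReal.ofReal η := by
  refine ⟨1, one_pos, fun D hD => ⟨1, 3, 1 / 144, one_pos, by norm_num, by norm_num,
    fun η hη hη1 => ?_⟩⟩
  have hQ : 1 ≤ (⌈D⌉₊ : ℝ) := hD.trans (Nat.le_ceil D)
  refine ⟨2300 * ⌈D⌉₊ / η, by positivity, ?_⟩
  intro H _ _ _ _ hc μ ψ hψ p s n hn hs hsp hLd Ω _ P W hW C hC
  have hC' : 2300 * (⌈D⌉₊ : ℝ) ≤ C * η := ((div_lt_iff₀ hη).1 hC).le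
  have hC0 : 0 < C := lt_trans (by positivity) hC
  refine (SparseAdditive.totalRisk_le hc hψ hn hs hsp hD hLd hW (by nlinarith)).trans
    (ENNReal.ofReal_le_ofReal ?_)
  rw [div_le_iff₀ hC0]
  linarith
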